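/- **Setting.** Let $\mathbb F$ be the set of convex functions $f:\mathbb R\to(-\infty,+\infty]$ with $f=+\infty$ on $(-\infty,0)$, $f$ right continuous at $0$, $f(1)=0$ and $1$ in the interior of $\{f<+\infty\}$; put $f^*(0)=\lim_{t\to0+}t\,f(1/t)\in(-\infty,+\infty]$. For probability measures $P,Q$ on a measurable space, let $p,q$ be their densities with respect to $P+Q$, let $h=p/q\in[0,+\infty]$ (with $0/0=0$), and $$D_f(P\,\Vert\,Q)=\int f(h)\,\mathrm dQ+f^*(0)\,P(h=+\infty)\in(-\infty,+\infty],$$ the last term being $0$ if $P\ll Q$. For random variables $X,Y$ on a common probability space, $S_f(X,Y)=D_f(P_X\otimes P_Y\,\Vert\,P_{(X,Y)})$. A $d$-dimensional copula is the restriction to $[0,1]^d$ of the joint cdf of a random vector whose one-dimensional marginals are all uniform on $[0,1]$; $D_f$ between copulas means $D_f$ between the corresponding probability distributions. A copula $C$ is a copula for a random vector $Z$ in $\mathbb R^d$ if $F_Z(z)=C(F_{Z_1}(z_1),\dots,F_{Z_d}(z_d))$ for all $z\in\mathbb R^d$. If $C_{(X,Y)}$ is a copula for $(X,Y)$, its marginals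 are $C_X(x)=C_{(X,Y)}(x,1,\dots,1)$ and $C_Y(y)=C_{(X,Y)}(1,\dots,1,y)$, and $(C_X\otimes C_Y)(x,y)=C_X(x)\,C_Y(y)$. For a real random variable $\xi$ let $\Delta(\xi)=\{x:\mathbb P(\xi=x)>0\}$. An interpolating copula for $Z=(Z_1,\dots,Z_d)$ is the cdf on $[0,1]^d$ of $(U_1,\dots,U_d)$, where $$U_i=F_{Z_i}(Z_i-)+\sum_{x\in\Delta(Z_i)}\mathbb P(Z_i=x)\,T_{i,x}\,\mathbf 1_{\{Z_i=x\}},$$ and $(T_{i,x})_{1\le i\le d,\,x\in\Delta(Z_i)}$ is a family, independent of $Z$, of random variables each uniform on $[0,1]$ (with arbitrary dependence among them). The checkerboard copula $C^{\mathrm{cb}}_Z$ is the one obtained when $T_{i,x}=T_i$ for all $x\in\Delta(Z_i)$, with $T_1,\dots,T_d$ independent and uniform on $[0,1]$. **Theorem.** Let $X=(X_1,\dots,X_{d_X})$ and $Y=(Y_1,\dots,Y_{d_Y})$ be real random vectors defined on the same probability space, and let $f\in\mathbb F$. (i) For every copula $C_{(X,Y)}$ for $(X,Y)$, with marginals $C_X$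 and $C_Y$, $$S_f(X,Y)\le D_f(C_X\otimes C_Y\,\Vert\,C_{(X,Y)}).$$ (ii) Let $T=(T_{i,x})_{1\le i\le d_X,\,x\in\Delta(X_i)}$ and $W=(W_{j,y})_{1\le j\le d_Y,\,y\in\Delta(Y_j)}$ be families of random variables each uniform on $[0,1]$, such that $T$ and $W$ are independent and the pair $(T,W)$ is independent of $(X,Y)$. Let $$U_i=F_{X_i}(X_i-)+\sum_{x\in\Delta(X_i)}\mathbb P(X_i=x)\,T_{i,x}\mathbf 1_{\{X_i=x\}},\qquad V_j=F_{Y_j}(Y_j-)+\sum_{y\in\Delta(Y_j)}\mathbb P(Y_j=y)\,W_{j,y}\mathbf 1_{\{Y_j=y\}},$$ and let $C^{\mathrm{ip}}_{(X,Y)}$ be the cdf of $(U,V)$ on $[0,1]^{d_X+d_Y}$. Then $C^{\mathrm{ip}}_{(X,Y)}$ is an interpolating copula for, and a copula for, $(X,Y)$; its marginals $C^{\mathrm{ip}}_X$ and $C^{\mathrm{ip}}_Y$ are the cdfs of $U$ and $V$ and are interpolating copulas for $X$ and $Y$, respectively; and $$S_f(X,Y)=D_f(C^{\mathrm{ip}}_X\otimes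 C^{\mathrm{ip}}_Y\,\Vert\,C^{\mathrm{ip}}_{(X,Y)}).$$ (iii) In particular, $C^{\mathrm{cb}}_{(X,Y)}$ is a copula for $(X,Y)$ with marginals $C^{\mathrm{cb}}_X$ and $C^{\mathrm{cb}}_Y$, and $$S_f(X,Y)=D_f(C^{\mathrm{cb}}_X\otimes C^{\mathrm{cb}}_Y\,\Vert\,C^{\mathrm{cb}}_{(X,Y)})=\min D_f(C_X\otimes C_Y\,\Vert\,C_{(X,Y)}),$$ where the minimum is over all copulas $C_{(X,Y)}$ for $(X,Y)$, with marginals $C_X$ and $C_Y$. -/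

import Mathlib

open MeasureTheory ProbabilityTheory Set Filter Topology
open scoped ENNReal unitInterval

noncomputable section

/-! ### `f`-divergences -/

/-- The class of divergence generators: proper convex functions `f : ℝ → (-∞, +∞]` with domain
`{f < +∞}` contained in `[0, +∞)`, right continuous at `0`, with `f 1 = 0` and with `1` in the
interior of the domain. -/
structure IsDivergenceFunction (f : ℝ → EReal) : Prop where
  ne_bot : ∀ t, f t ≠ ⊥
  convex : ∀ x y a : ℝ, 0 ≤ a → a ≤ 1 →
    f (a * x + (1 - a) * y) ≤ (a : EReal) * f x + ((1 - a : ℝ) : EReal) * f y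
  eq_top_of_neg : ∀ t < 0, f t = ⊤
  right_continuous_zero : Tendsto f (𝓝[>] 0) (𝓝 (f 0))
  map_one : f 1 = 0
  one_mem_interior : (1 : ℝ) ∈ interior {t | f t ≠ ⊤}

/-- The value at `0` of the convex conjugate `f* (t) = t * f (1 / t)`, extended by right continuity.
The limit exists in `(-∞, +∞]` for each divergence generator `f`, by convexity. -/
def conjAtZero (f : ℝ → EReal) : EReal :=
  limUnder (𝓝[>] (0 : ℝ)) fun t => (t : EReal) * f (1 / t)

/-- The integral `∫ g₊ dμ - ∫ g₋ dμ` of an extended-real function (meaningful when one of the two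
terms is finite). -/
def integralEReal {α : Type*} [MeasurableSpace α] (μ : Measure α) (g : α → EReal) : EReal :=
  ((∫⁻ x, (g x).toENNReal ∂μ : ℝ≥0∞) : EReal) - ((∫⁻ x, (-g x).toENNReal ∂μ : ℝ≥0∞) : EReal)

/-- The `[0, +∞]`-valued density `dP/dQ = p / q`, where `p` and `q` are the densities of `P` and `Q`
with respect to `P + Q` (and `0 / 0 = 0`, `p / 0 = +∞` for `p > 0`). -/
def extDensity {α : Type*} [MeasurableSpace α] (P Q : Measure α) (x : α) : ℝ≥0∞ :=
  P.rnDeriv (P + Q) x / Q.rnDeriv (P + Q) x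

/-- The `f`-divergence `D_f(P ‖ Q) = ∫ f (dP/dQ) dQ + f*(0) P(dP/dQ = +∞)`, the last term being `0`
when `P ≪ Q` (in `EReal` one has `⊤ * 0 = 0`). Since `dP/dQ < +∞` holds `Q`-a.e., only the
values of `f` on finite arguments matter in the integral. -/
def fDivergence {α : Type*} [MeasurableSpace α] (f : ℝ → EReal) (P Q : Measure α) : EReal :=
  integralEReal Q (fun x => f (extDensity P Q x).toReal)
    + conjAtZero f * ((P {x | extDensity P Q x = ⊤} : ℝ≥0∞) : EReal)

/-- The Csiszár index `S_f(X, Y) = D_f(P_X ⊗ P_Y ‖ P_(X,Y))`. -/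
def csiszarIndex {Ω α β : Type*} [MeasurableSpace Ω] [MeasurableSpace α] [MeasurableSpace β]
    (P : Measure Ω) (f : ℝ → EReal) (X : Ω → α) (Y : Ω → β) : EReal :=
  fDivergence f ((P.map X).prod (P.map Y)) (P.map fun ω => (X ω, Y ω))

/-! ### Copulas -/

/-- The uniform distribution on `[0, 1]`. -/
def uniformUnit : Measure ℝ := volume.restrict (Icc 0 1)

/-- The joint cumulative distribution function of a measure on `ℝ^ι`. -/
def jointCdf {ι : Type*} (μ : Measure (ι → ℝ)) (z : ι → ℝ) : ℝ :=
  μ.real {w | ∀ i, w i ≤ z i}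

/-- The joint cumulative distribution function restricted to `[0, 1]^ι`. -/
def cubeCdf {ι : Type*} (μ : Measure (ι → ℝ)) (u : ι → I) : ℝ :=
  jointCdf μ fun i => (u i : ℝ)

/-- `μ` is a probability measure on `ℝ^ι` whose one-dimensional marginals are uniform on
`[0, 1]`. -/
def HasUniformMarginals {ι : Type*} (μ : Measure (ι → ℝ)) : Prop :=
  IsProbabilityMeasure μ ∧ ∀ i, μ.map (fun w => w i) = uniformUnit

/-- A copula: the restriction to `[0, 1]^ι` of the joint cdf of a random vector all of whose
one-dimensional marginals are uniform on `[0, 1]`. -/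
def IsCopula {ι : Type*} (C : (ι → I) → ℝ) : Prop :=
  ∃ μ : Measure (ι → ℝ), HasUniformMarginals μ ∧ C = cubeCdf μ

open Classical in
/-- The probability distribution on `ℝ^ι` (carried by `[0, 1]^ι`) whose cdf is the copula `C`; it is
unique, see `copulaMeasure_cubeCdf`. -/
def copulaMeasure {ι : Type*} (C : (ι → I) → ℝ) : Measure (ι → ℝ) :=
  if h : IsCopula C then h.choose else 0

/-- The `f`-divergence between copulas: the `f`-divergence between the corresponding
distributions. -/
def copulaDivergence {ι : Type*} (f : ℝ → EReal) (C C' : (ι → I) → ℝ) : EReal :=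
  fDivergence f (copulaMeasure C) (copulaMeasure C')

/-- `C` is a copula for the random vector `Z`: it is a copula and
`F_Z(z) = C(F_{Z_1}(z_1), …, F_{Z_d}(z_d))` for all `z`. -/
def IsCopulaFor {Ω ι : Type*} [MeasurableSpace Ω] (P : Measure Ω) (Z : Ω → ι → ℝ)
    (C : (ι → I) → ℝ) : Prop :=
  IsCopula C ∧ ∀ z : ι → ℝ, jointCdf (P.map Z) z =
    C fun i => ⟨cdf (P.map fun ω => Z ω i) (z i), cdf_nonneg _ _, cdf_le_one _ _⟩

/-- The random vector `(X, Y)`, with coordinates indexed by the disjoint union `ι ⊕ κ`. -/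
def joinVec {Ω ι κ : Type*} (X : Ω → ι → ℝ) (Y : Ω → κ → ℝ) (ω : Ω) : ι ⊕ κ → ℝ :=
  Sum.elim (X ω) (Y ω)

/-- The marginal `C_X(x) = C(x, 1, …, 1)`. -/
def marginLeft {ι κ : Type*} (C : (ι ⊕ κ → I) → ℝ) (x : ι → I) : ℝ :=
  C (Sum.elim x fun _ => 1)

/-- The marginal `C_Y(y) = C(1, …, 1, y)`. -/
def marginRight {ι κ : Type*} (C : (ι ⊕ κ → I) → ℝ) (y : κ → I) : ℝ :=
  C (Sum.elim (fun _ => 1) y)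

/-- The tensor product `(A ⊗ B)(x, y) = A(x) B(y)`. -/
def copulaTensor {ι κ : Type*} (A : (ι → I) → ℝ) (B : (κ → I) → ℝ) (u : ι ⊕ κ → I) : ℝ :=
  A (fun i => u (Sum.inl i)) * B (fun j => u (Sum.inr j))

/-! ### Interpolating and checkerboard copulas -/

/-- The set `Δ(ξ)` of atoms of a real random variable. -/
def atoms {Ω : Type*} [MeasurableSpace Ω] (P : Measure Ω) (ξ : Ω → ℝ) : Set ℝ :=
  {x | 0 < P {ω | ξ ω = x}}

/-- The vector with coordinates
`F_{Z_i}(z_i -) + ∑_{x ∈ Δ(Z_i)} P(Z_i = x) t_{i,x} 1_{z_i = x}`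
(each sum has at most one nonzero term). -/
def randomizedTransform {Ω ι : Type*} [MeasurableSpace Ω] (P : Measure Ω) (Z : Ω → ι → ℝ)
    (z : ι → ℝ) (t : ∀ i, atoms P (fun ω => Z ω i) → ℝ) (i : ι) : ℝ :=
  Function.leftLim (cdf (P.map fun ω => Z ω i)) (z i)
    + ∑' x : atoms P (fun ω => Z ω i),
        P.real {ω | Z ω i = x} * t i x * Set.indicator {(x : ℝ)} (fun _ => (1 : ℝ)) (z i)

/-- The cdf on `[0, 1]^ι` of the vector
`U_i = F_{Z_i}(Z_i -) + ∑_{x ∈ Δ(Z_i)} P(Z_i = x) T_{i,x} 1_{Z_i = x}`, where the family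
`T = (T_{i,x})` has distribution `ν` and is independent of `Z`. -/
def randomizedCdf {Ω ι : Type*} [MeasurableSpace Ω] (P : Measure Ω) (Z : Ω → ι → ℝ)
    (ν : Measure (∀ i, atoms P (fun ω => Z ω i) → ℝ)) : (ι → I) → ℝ :=
  cubeCdf ((P.prod ν).map fun p => randomizedTransform P Z (Z p.1) p.2)

/-- `C` is an interpolating copula for `Z`: it is the cdf of the randomized vector `U` for some
family `T = (T_{i,x})`, independent of `Z`, of random variables that are uniform on `[0, 1]`, with
an arbitrary dependence among them. -/
def IsInterpolatingCopula {Ω ι : Type*} [MeasurableSpace Ω] (P : Measure Ω) (Z : Ω → ι → ℝ)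
    (C : (ι → I) → ℝ) : Prop :=
  ∃ ν : Measure (∀ i, atoms P (fun ω => Z ω i) → ℝ), IsProbabilityMeasure ν ∧
    (∀ i x, ν.map (fun t => t i x) = uniformUnit) ∧ C = randomizedCdf P Z ν

/-- The checkerboard copula for `Z`: for each `i` the variables `T_{i,x}` all equal a single
`T_i`, and the `T_i` are independent, uniform on `[0, 1]`, and independent of `Z`. -/
def checkerboardCopula {Ω ι : Type*} [Fintype ι] [MeasurableSpace Ω] (P : Measure Ω)
    (Z : Ω → ι → ℝ) : (ι → I) → ℝ :=
  randomizedCdf P Z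
    ((Measure.pi fun _ : ι => uniformUnit).map fun s i (_ : atoms P (fun ω => Z ω i)) => s i)

/-! ### The distribution with a given copula as cdf is unique -/

theorem HasUniformMarginals.ae_mem {ι : Type*} [Finite ι] {μ : Measure (ι → ℝ)}
    (h : HasUniformMarginals μ) : ∀ᵐ w ∂μ, ∀ i, w i ∈ Icc (0 : ℝ) 1 := by
  rw [ae_all_iff]
  intro i
  have h1 : ∀ᵐ x ∂(μ.map fun w => w i), x ∈ Icc (0 : ℝ) 1 := by
    rw [h.2 i]
    exact ae_restrict_mem measurableSet_Icc
  exact ae_of_ae_map (measurable_pi_apply i).aemeasurable h1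

theorem HasUniformMarginals.ext {ι : Type*} [Finite ι] {μ ν : Measure (ι → ℝ)}
    (hμ : HasUniformMarginals μ) (hν : HasUniformMarginals ν) (h : cubeCdf μ = cubeCdf ν) :
    μ = ν := by
  have := hμ.1
  have := hν.1
  have key : ∀ z : ι → ℝ, μ {w | ∀ i, w i ≤ z i} = ν {w | ∀ i, w i ≤ z i} := by
    intro z
    by_cases hz : ∀ i, 0 ≤ z i
    · have hc : ∀ ρ : Measure (ι → ℝ), HasUniformMarginals ρ →
          ρ {w | ∀ i, w i ≤ z i} = ρ {w | ∀ i, w i ≤ min (z i) 1} := by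
        intro ρ hρ
        apply measure_congr
        filter_upwards [hρ.ae_mem] with w hw
        refine propext ⟨fun H i => le_min (H i) (hw i).2, fun H i => (H i).trans (min_le_left _ _)⟩
      rw [hc μ hμ, hc ν hν]
      have := congrFun h fun i => ⟨min (z i) 1, le_min (hz i) zero_le_one, min_le_right _ _⟩
      simpa [cubeCdf, jointCdf, Measure.real, ENNReal.toReal_eq_toReal_iff] using this
    · push Not at hz
      obtain ⟨i, hi⟩ := hz
      have hc : ∀ ρ : Measure (ι → ℝ), HasUniformMarginals ρ → ρ {w | ∀ i, w i ≤ z i} = 0 := by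
        intro ρ hρ
        rw [measure_eq_zero_iff_ae_notMem]
        filter_upwards [hρ.ae_mem] with w hw H
        exact absurd ((hw i).1.trans (H i)) (not_le.2 hi)
      rw [hc μ hμ, hc ν hν]
  have hgen : (MeasurableSpace.pi : MeasurableSpace (ι → ℝ)) =
      MeasurableSpace.generateFrom (Set.pi univ '' Set.pi univ fun _ : ι => range (Iic (α := ℝ))) := by
    rw [← generateFrom_pi_eq]
    · congr 1
      funext i
      exact (BorelSpace.measurable_eq (α := ℝ)).trans (borel_eq_generateFrom_Iic ℝ)
    · intro i
      refine ⟨fun n => Iic (n : ℝ), fun n => mem_range_self _, ?_⟩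
      exact iUnion_eq_univ_iff.2 fun x => exists_nat_ge x
  refine ext_of_generate_finite _ hgen ?_ ?_ (by simp)
  · exact IsPiSystem.pi fun _ => isPiSystem_Iic
  · rintro s ⟨t, ht, rfl⟩
    choose z hz using fun i => ht i (mem_univ i)
    have : Set.pi univ t = {w | ∀ i, w i ≤ z i} := by
      ext w
      simp [← hz]
    rw [this, key]

theorem copulaMeasure_cubeCdf {ι : Type*} [Finite ι] {μ : Measure (ι → ℝ)}
    (hμ : HasUniformMarginals μ) : copulaMeasure (cubeCdf μ) = μ := by
  have h : IsCopula (cubeCdf μ) := ⟨μ, hμ, rfl⟩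
  rw [copulaMeasure, dif_pos h]
  exact h.choose_spec.1.ext hμ h.choose_spec.2.symm

end

/-! Both inequalities are data processing: a divergence cannot grow when both measures are pushed
through the same map.

For the lower bound, coordinatewise quantile functions send a vector distributed according to a
copula for `(X, Y)` to one with the law of `(X, Y)`. Since they act on the two blocks separately,
they also send the product of the block marginals to `P_X ⊗ P_Y`
(`csiszarIndex_le_copulaDivergence`).

For the converse, `(U, V)` is a fixed function of the values `(x, y)` and the noise `(t, w)`. As `T`
and `W` are independent, this function carries `P_(X,Y) ⊗ (νT ⊗ νW)` to the law of `(U, V)` and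
`(P_X ⊗ P_Y) ⊗ (νT ⊗ νW)` to the product of the laws of `U` and `V`. Tensoring with a common noise
changes neither density nor divergence, so data processing gives the reverse inequality
(`randomizedCdf_joinVec`). Checkerboard noise is of this kind.

Data processing is proved for generators that may take the value `⊤` and without absolute continuity
(`IsExtDensity.divMeasure_map_univ_le`). Subtracting a supporting line `c * (t - 1)` makes the
generator nonnegative and turns the divergence into the total mass of a measure, which is compared
with its image piece by piece according to the value of the image density `h'`. Where `h'` is near
an interior point of the domain, the tangent line bounds the generator from below upstairs and, up
to `ε`, from above downstairs; the integral of an affine function of the density involves only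
masses that the map preserves. At or beyond an end of the domain, preservation of mass forces both
densities to equal the end value.

That the randomized vectors have copulas for `Z` as cdfs rests on the fact that `U_i` spreads each
atom of `Z_i` uniformly over the corresponding jump of the cdf. -/

noncomputable section

/-! ### Extended densities -/

/-- `h` is a `[0, +∞]`-valued density of `P` with respect to `Q`: on `{h < +∞}` the measure `P` has
density `h`, and `{h = +∞}` is `Q`-null. -/
structure IsExtDensity {α : Type*} [MeasurableSpace α] (P Q : Measure α) (h : α → ℝ≥0∞) :
    Prop where
  measurable : Measurable h
  apply_eq : ∀ A, MeasurableSet A → P A = ∫⁻ x in A, h x ∂Q + P (A ∩ {x | h x = ⊤})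
  null : Q {x | h x = ⊤} = 0

/-- With respect to `P + Q` the formula becomes the pointwise identity `q * (p / q) + p * 1_{p / q =
⊤} = p` for finite `p` and `q`. For finite `p`, the quotient is infinite only where `q = 0`. -/
theorem isExtDensity_extDensity {α : Type*} [MeasurableSpace α] (P Q : Measure α)
    [IsFiniteMeasure P] [IsFiniteMeasure Q] : IsExtDensity P Q (extDensity P Q) := by
  have hP : P ≪ P + Q := Measure.absolutelyContinuous_of_le (Measure.le_add_right le_rfl)
  have hQ : Q ≪ P + Q := Measure.absolutelyContinuous_of_le (Measure.le_add_left le_rfl)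
  set p := P.rnDeriv (P + Q) with hp
  set q := Q.rnDeriv (P + Q) with hq
  have mp : Measurable p := Measure.measurable_rnDeriv _ _
  have mq : Measurable q := Measure.measurable_rnDeriv _ _
  have hm : Measurable (extDensity P Q) := mp.div mq
  have hPd : (P + Q).withDensity p = P := Measure.withDensity_rnDeriv_eq _ _ hP
  have hQd : (P + Q).withDensity q = Q := Measure.withDensity_rnDeriv_eq _ _ hQ
  have hpt : ∀ᵐ x ∂(P + Q), p x ≠ ⊤ := Measure.rnDeriv_ne_top _ _
  have hqt : ∀ᵐ x ∂(P + Q), q x ≠ ⊤ := Measure.rnDeriv_ne_top _ _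
  have hT : MeasurableSet {x | extDensity P Q x = ⊤} := hm (measurableSet_singleton _)
  have hPA : ∀ A, MeasurableSet A → P A = ∫⁻ x in A, p x ∂(P + Q) := fun A hA => by
    rw [← withDensity_apply _ hA, hPd]
  refine ⟨hm, fun A hA => ?_, ?_⟩
  · rw [hPA A hA, hPA _ (hA.inter hT)]
    have h1 : ∫⁻ x in A, extDensity P Q x ∂Q
        = ∫⁻ x in A, q x * extDensity P Q x ∂(P + Q) := by
      have := setLIntegral_withDensity_eq_setLIntegral_mul (P + Q) mq hm hA
      rw [hQd] at this
      exact this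
    rw [h1, inter_comm A, ← Measure.restrict_restrict hT, ← lintegral_indicator hT,
      ← lintegral_add_left (f := fun x => q x * extDensity P Q x) (mq.mul hm)]
    refine lintegral_congr_ae (ae_restrict_of_ae ?_)
    filter_upwards [hpt, hqt] with x hx hx'
    simp only [indicator, mem_ofPred_eq, extDensity, ← hp, ← hq]
    by_cases h0 : q x = 0
    · by_cases h0' : p x = 0 <;> simp [h0, h0', ENNReal.div_zero]
    · rw [if_neg (ENNReal.div_ne_top hx h0), add_zero, ENNReal.mul_div_cancel h0 hx']
  · have hQA : Q {x | extDensity P Q x = ⊤} = ∫⁻ x in {x | extDensity P Q x = ⊤}, q x ∂(P + Q) := by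
      rw [← withDensity_apply _ hT, hQd]
    rw [hQA, ← lintegral_indicator hT]
    refine lintegral_eq_zero_of_ae_eq_zero ?_
    filter_upwards [hpt] with x hx
    simp only [indicator, mem_ofPred_eq, extDensity, ← hp, ← hq, Pi.zero_apply]
    split_ifs with h
    · by_contra h0
      exact ENNReal.div_ne_top hx h0 h
    · rfl

/-- The decomposition `P = h Q + P|_{h = ⊤}` survives tensoring with `R`, so independent noise does
not alter the density. -/
theorem IsExtDensity.comp_fst {α β : Type*} [MeasurableSpace α] [MeasurableSpace β]
    {P Q : Measure α} {h : α → ℝ≥0∞} [IsFiniteMeasure P] [IsFiniteMeasure Q]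
    (H : IsExtDensity P Q h) (R : Measure β) [IsProbabilityMeasure R] :
    IsExtDensity (P.prod R) (Q.prod R) fun x => h x.1 := by
  have hm : Measurable fun x : α × β => h x.1 := H.measurable.comp measurable_fst
  have hT : MeasurableSet {x | h x = ⊤} := H.measurable (measurableSet_singleton _)
  have hT' : MeasurableSet {x : α × β | h x.1 = ⊤} := hm (measurableSet_singleton _)
  have hd : P = Q.withDensity h + P.restrict {x | h x = ⊤} := by
    ext A hA
    rw [Measure.add_apply, withDensity_apply _ hA, Measure.restrict_apply hA]
    exact H.apply_eq A hA
  refine ⟨hm, fun A hA => ?_, ?_⟩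
  · have hmk : Measurable fun x => R (Prod.mk x ⁻¹' A) := measurable_measure_prodMk_left hA
    rw [Measure.prod_apply hA, Measure.prod_apply (hA.inter hT'), ← lintegral_indicator hA,
      lintegral_prod _ (hm.indicator hA).aemeasurable]
    conv_lhs => rw [hd]
    rw [lintegral_add_measure, lintegral_withDensity_eq_lintegral_mul _ H.measurable hmk,
      ← lintegral_indicator hT]
    congr 1
    · refine lintegral_congr fun x => ?_
      have : ∀ y, A.indicator (fun x : α × β => h x.1) (x, y)
          = (Prod.mk x ⁻¹' A).indicator (fun _ => h x) y := fun y => by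
        simp only [indicator, mem_preimage]
        congr
      simp_rw [this]
      rw [lintegral_indicator (measurable_prodMk_left hA), lintegral_const]
      simp
    · refine lintegral_congr fun x => ?_
      by_cases hx : h x = ⊤ <;> simp [indicator, hx, preimage_inter]
  · have : {x : α × β | h x.1 = ⊤} = {x | h x = ⊤} ×ˢ univ := by ext; simp
    rw [this, Measure.prod_prod, H.null, zero_mul]

/-! ### Nonnegative generators and the data processing inequality -/

/-- A `[0, +∞]`-valued generator `g` together with the value `κ` of its conjugate at `0`; only the
consequences of convexity used for the data processing inequality are recorded. -/
structure IsNonnegGenerator (g : ℝ → ℝ≥0∞) (κ : ℝ≥0∞) : Prop where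
  measurable : Measurable g
  ordConnected : {t | g t ≠ ⊤}.OrdConnected
  nonneg : ∀ t, g t ≠ ⊤ → 0 ≤ t
  nonempty : ∃ t, g t ≠ ⊤
  tangent : ∀ t ∈ interior {t | g t ≠ ⊤}, ∃ a b : ℝ, (∀ s, ENNReal.ofReal (a * s + b) ≤ g s) ∧
    ENNReal.ofReal a ≤ κ ∧
    ∀ ε > 0, ∀ᶠ s in 𝓝 t, g s ≠ ⊤ ∧ (g s).toReal ≤ a * s + b + ε
  slope_top : BddAbove {t | g t ≠ ⊤} → κ = ⊤

/-- The set function `A ↦ ∫_A g(h) dQ + κ P(A ∩ {h = +∞})`. -/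
def divMeasure {α : Type*} [MeasurableSpace α] (g : ℝ → ℝ≥0∞) (κ : ℝ≥0∞) (P Q : Measure α)
    (h : α → ℝ≥0∞) : Measure α :=
  Q.withDensity (fun x => g (h x).toReal) + κ • P.restrict {x | h x = ⊤}

theorem divMeasure_apply {α : Type*} [MeasurableSpace α] (g : ℝ → ℝ≥0∞) (κ : ℝ≥0∞)
    (P Q : Measure α) (h : α → ℝ≥0∞) {A : Set α} (hA : MeasurableSet A) :
    divMeasure g κ P Q h A = ∫⁻ x in A, g (h x).toReal ∂Q + κ * P (A ∩ {x | h x = ⊤}) := by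
  simp [divMeasure, withDensity_apply _ hA, Measure.restrict_apply hA]

/-- Moving negative parts to the other side lets affine bounds with coefficients of any sign be
integrated in `[0, ∞]`, without subtraction. -/
theorem ofReal_add_ofReal_le (x y : ℝ) : ENNReal.ofReal x + ENNReal.ofReal y ≤
    ENNReal.ofReal (x + y) + (ENNReal.ofReal (-x) + ENNReal.ofReal (-y)) := by
  simp only [ENNReal.ofReal]
  norm_cast
  rw [← NNReal.coe_le_coe]
  push_cast
  simp only [Real.coe_toNNReal']
  grind

theorem ofReal_add_le_of_le {r x y z : ℝ} (hr : 0 ≤ r) (h : r ≤ x + y + z) :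
    ENNReal.ofReal r + (ENNReal.ofReal (-x) + ENNReal.ofReal (-y)) ≤
      ENNReal.ofReal x + (ENNReal.ofReal y + ENNReal.ofReal z) := by
  simp only [ENNReal.ofReal]
  norm_cast
  rw [← NNReal.coe_le_coe]
  push_cast
  simp only [Real.coe_toNNReal']
  grind

/-- An affine minorant of the generator bounds the divergence measure from below. -/
theorem IsExtDensity.le_divMeasure {α : Type*} [MeasurableSpace α] {P Q : Measure α}
    {h : α → ℝ≥0∞} {g : ℝ → ℝ≥0∞} {κ : ℝ≥0∞} (hg : Measurable g) (H : IsExtDensity P Q h)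
    {a b : ℝ} (hab : ∀ s, ENNReal.ofReal (a * s + b) ≤ g s) (ha : ENNReal.ofReal a ≤ κ)
    {A : Set α} (hA : MeasurableSet A) :
    ENNReal.ofReal a * P A + ENNReal.ofReal b * Q A ≤
      divMeasure g κ P Q h A + (ENNReal.ofReal (-a) * P A + ENNReal.ofReal (-b) * Q A) := by
  have hm := H.measurable
  have key : ∀ x, h x ≠ ⊤ → ENNReal.ofReal a * h x + ENNReal.ofReal b ≤
      g (h x).toReal + (ENNReal.ofReal (-a) * h x + ENNReal.ofReal (-b)) := by
    intro x hx
    refine le_trans ?_ (add_le_add_left (hab (h x).toReal) _)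
    lift h x to NNReal using hx with s
    rw [ENNReal.coe_toReal, ← ENNReal.ofReal_coe_nnreal]
    rw [← ENNReal.ofReal_mul' s.coe_nonneg, ← ENNReal.ofReal_mul' s.coe_nonneg, neg_mul]
    exact ofReal_add_ofReal_le _ _
  have hint : ENNReal.ofReal a * ∫⁻ x in A, h x ∂Q + ENNReal.ofReal b * Q A ≤
      ∫⁻ x in A, g (h x).toReal ∂Q +
        (ENNReal.ofReal (-a) * ∫⁻ x in A, h x ∂Q + ENNReal.ofReal (-b) * Q A) := by
    have e : ∀ c d : ℝ≥0∞, c * ∫⁻ x in A, h x ∂Q + d * Q A = ∫⁻ x in A, (c * h x + d) ∂Q := by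
      intro c d
      rw [lintegral_add_right _ measurable_const, lintegral_const_mul _ hm, setLIntegral_const]
    rw [e, e, ← lintegral_add_left (f := fun x => g (h x).toReal) (hg.comp hm.ennreal_toReal)]
    refine lintegral_mono_ae (ae_restrict_of_ae ?_)
    filter_upwards [measure_eq_zero_iff_ae_notMem.1 H.null] with x hx
    exact key x hx
  rw [divMeasure_apply _ _ _ _ _ hA, H.apply_eq A hA]
  calc _ = (ENNReal.ofReal a * ∫⁻ x in A, h x ∂Q + ENNReal.ofReal b * Q A)
        + ENNReal.ofReal a * P (A ∩ {x | h x = ⊤}) := by ring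
    _ ≤ (∫⁻ x in A, g (h x).toReal ∂Q +
        (ENNReal.ofReal (-a) * ∫⁻ x in A, h x ∂Q + ENNReal.ofReal (-b) * Q A))
        + (κ * P (A ∩ {x | h x = ⊤}) + ENNReal.ofReal (-a) * P (A ∩ {x | h x = ⊤})) := by
      -- On `{h = ⊤}` the affine minorant is replaced by the bound of its slope by `κ`.
      refine add_le_add hint (le_add_right ?_)
      gcongr
    _ = _ := by ring

/-- An affine function that nearly majorizes the generator on the values of `h` bounds the
divergence measure from above. -/
theorem IsExtDensity.divMeasure_le {α : Type*} [MeasurableSpace α] {P Q : Measure α}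
    {h : α → ℝ≥0∞} {g : ℝ → ℝ≥0∞} {κ : ℝ≥0∞} (hg : Measurable g) (H : IsExtDensity P Q h)
    {a b ε : ℝ} {A : Set α} (hA : MeasurableSet A)
    (hab : ∀ x ∈ A, h x ≠ ⊤ ∧ g (h x).toReal ≠ ⊤ ∧
      (g (h x).toReal).toReal ≤ a * (h x).toReal + b + ε) :
    divMeasure g κ P Q h A + (ENNReal.ofReal (-a) * P A + ENNReal.ofReal (-b) * Q A) ≤
      ENNReal.ofReal a * P A + ENNReal.ofReal b * Q A + ENNReal.ofReal ε * Q A := by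
  have hm := H.measurable
  have key : ∀ x ∈ A, g (h x).toReal + (ENNReal.ofReal (-a) * h x + ENNReal.ofReal (-b)) ≤
      ENNReal.ofReal a * h x + (ENNReal.ofReal b + ENNReal.ofReal ε) := by
    intro x hx
    obtain ⟨hx1, hx2, hx3⟩ := hab x hx
    lift h x to NNReal using hx1 with s
    rw [ENNReal.coe_toReal] at *
    rw [← ENNReal.ofReal_toReal hx2, ← ENNReal.ofReal_coe_nnreal (p := s)]
    rw [← ENNReal.ofReal_mul' s.coe_nonneg, ← ENNReal.ofReal_mul' s.coe_nonneg, neg_mul]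
    exact ofReal_add_le_of_le ENNReal.toReal_nonneg hx3
  have hPA : P A = ∫⁻ x in A, h x ∂Q := by
    rw [H.apply_eq A hA, show A ∩ {x | h x = ⊤} = ∅ from ?_, measure_empty, add_zero]
    exact eq_empty_of_forall_notMem fun x hx => (hab x hx.1).1 hx.2
  have e : ∀ c d : ℝ≥0∞, c * ∫⁻ x in A, h x ∂Q + d * Q A = ∫⁻ x in A, (c * h x + d) ∂Q := by
    intro c d
    rw [lintegral_add_right _ measurable_const, lintegral_const_mul _ hm, setLIntegral_const]
  rw [divMeasure_apply _ _ _ _ _ hA, show A ∩ {x | h x = ⊤} = ∅ from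
    eq_empty_of_forall_notMem fun x hx => (hab x hx.1).1 hx.2, measure_empty, mul_zero, add_zero,
    hPA, add_assoc (ENNReal.ofReal a * _), ← add_mul, e, e,
    ← lintegral_add_left (f := fun x => g (h x).toReal) (hg.comp hm.ennreal_toReal)]
  exact setLIntegral_mono' hA key

/-- The hypothesis covers all measurable subsets of each `B` because the cover is made disjoint
before summing. -/
theorem measure_univ_le_of_sUnion {β : Type*} [MeasurableSpace β] {μ ν : Measure β}
    {S : Set (Set β)} (hS : S.Countable) (hm : ∀ B ∈ S, MeasurableSet B)
    (h : ∀ B ∈ S, ∀ A ⊆ B, MeasurableSet A → μ A ≤ ν A) (hc : ∀ x, ∃ B ∈ S, x ∈ B) :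
    μ univ ≤ ν univ := by
  rcases S.eq_empty_or_nonempty with rfl | hne
  · rw [show (univ : Set β) = ∅ from eq_empty_of_forall_notMem fun x _ => by simpa using hc x]
    simp
  obtain ⟨s, rfl⟩ := hS.exists_eq_range hne
  have hms : ∀ n, MeasurableSet (s n) := fun n => hm _ (mem_range_self n)
  have hU : (univ : Set β) = ⋃ n, disjointed s n := by
    rw [iUnion_disjointed]
    refine (eq_univ_of_forall fun x => ?_).symm
    obtain ⟨_, ⟨n, rfl⟩, hx⟩ := hc x
    exact mem_iUnion.2 ⟨n, hx⟩
  rw [hU, measure_iUnion (disjoint_disjointed s) fun n => .disjointed hms n,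
    measure_iUnion (disjoint_disjointed s) fun n => .disjointed hms n]
  exact ENNReal.tsum_le_tsum fun n =>
    h _ (mem_range_self n) _ (disjointed_subset s n) (.disjointed hms n)

section DataProcessing

variable {α β : Type*} [MeasurableSpace α] [MeasurableSpace β] {P Q : Measure α}
  {h : α → ℝ≥0∞} {g : ℝ → ℝ≥0∞} {κ : ℝ≥0∞} {φ : α → β} {h' : β → ℝ≥0∞}

/-- Such an `A` is null for the image of `Q`, so on its preimage all of `P` sits on `{h = ⊤}`, and
only the terms with `κ` remain. -/
theorem IsExtDensity.divMeasure_map_le_of_top (H : IsExtDensity P Q h) (hφ : Measurable φ)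
    (H' : IsExtDensity (P.map φ) (Q.map φ) h') {A : Set β} (hA : MeasurableSet A)
    (hsub : ∀ x ∈ A, h' x = ⊤) :
    divMeasure g κ (P.map φ) (Q.map φ) h' A ≤ divMeasure g κ P Q h (φ ⁻¹' A) := by
  have hQ' : Q.map φ A = 0 := measure_mono_null hsub H'.null
  have hQ : Q (φ ⁻¹' A) = 0 := by rwa [Measure.map_apply hφ hA] at hQ'
  rw [divMeasure_apply _ _ _ _ _ hA, divMeasure_apply _ _ _ _ _ (hφ hA),
    setLIntegral_measure_zero _ _ hQ', zero_add, setLIntegral_measure_zero _ _ hQ, zero_add]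
  gcongr
  calc _ ≤ P.map φ A := measure_mono inter_subset_left
    _ = P (φ ⁻¹' A) := Measure.map_apply hφ hA
    _ = _ := by rw [H.apply_eq _ (hφ hA), setLIntegral_measure_zero _ _ hQ, zero_add]

/-- This serves the ends of the domain, where no tangent line is available: equal constant densities
give equal integrals, and the singular part upstairs only helps. -/
theorem IsExtDensity.divMeasure_map_le_of_eq_const (hφ : Measurable φ) {A : Set β}
    (hA : MeasurableSet A) (htop : ∀ x ∈ A, h' x ≠ ⊤) {c : ℝ≥0∞}
    (hc : ∀ᵐ x ∂Q.restrict (φ ⁻¹' A), h x = c) (hc' : ∀ᵐ x ∂(Q.map φ).restrict A, h' x = c) :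
    divMeasure g κ (P.map φ) (Q.map φ) h' A ≤ divMeasure g κ P Q h (φ ⁻¹' A) := by
  rw [divMeasure_apply _ _ _ _ _ hA, divMeasure_apply _ _ _ _ _ (hφ hA),
    show A ∩ {x | h' x = ⊤} = ∅ from eq_empty_of_forall_notMem fun x hx => htop x hx.1 hx.2,
    measure_empty, mul_zero, add_zero]
  refine le_add_right (le_of_eq ?_)
  rw [lintegral_congr_ae (hc.mono fun x hx => by simp only [hx] :
      (fun x => g (h x).toReal) =ᵐ[Q.restrict (φ ⁻¹' A)] fun _ => g c.toReal),
    lintegral_congr_ae (hc'.mono fun x hx => by simp only [hx] :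
      (fun x => g (h' x).toReal) =ᵐ[(Q.map φ).restrict A] fun _ => g c.toReal),
    setLIntegral_const, setLIntegral_const, Measure.map_apply hφ hA]

/-- The lower bound upstairs and the upper bound downstairs involve the same combination of `P (φ
⁻¹' A)` and `Q (φ ⁻¹' A)`, which cancels. -/
theorem IsExtDensity.divMeasure_map_le_of_tangent [IsFiniteMeasure P] [IsFiniteMeasure Q]
    (hg : Measurable g) (H : IsExtDensity P Q h) (hφ : Measurable φ)
    (H' : IsExtDensity (P.map φ) (Q.map φ) h') {A : Set β} (hA : MeasurableSet A) {a b ε : ℝ}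
    (hab : ∀ s, ENNReal.ofReal (a * s + b) ≤ g s) (ha : ENNReal.ofReal a ≤ κ)
    (hsub : ∀ x ∈ A, h' x ≠ ⊤ ∧ g (h' x).toReal ≠ ⊤ ∧
      (g (h' x).toReal).toReal ≤ a * (h' x).toReal + b + ε) :
    divMeasure g κ (P.map φ) (Q.map φ) h' A ≤
      divMeasure g κ P Q h (φ ⁻¹' A) + ENNReal.ofReal ε * Q.map φ A := by
  have h1 := H.le_divMeasure hg hab ha (hφ hA)
  have h2 := H'.divMeasure_le (κ := κ) hg hA hsub
  rw [← Measure.map_apply hφ hA, ← Measure.map_apply hφ hA] at h1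
  set X := ENNReal.ofReal (-a) * P.map φ A + ENNReal.ofReal (-b) * Q.map φ A with hX
  have hXt : X ≠ ⊤ := by
    rw [hX]
    finiteness
  refine (ENNReal.add_le_add_iff_right hXt).1 (h2.trans ?_)
  calc _ ≤ _ := add_le_add_left h1 _
    _ = _ := by ring

/-- The chain `P (φ ⁻¹' A) ≤ b * Q (φ ⁻¹' A) = b * Q.map φ A ≤ P.map φ A` closes up, so both
densities equal `b` almost everywhere on the sets concerned. -/
theorem IsExtDensity.divMeasure_map_le_of_upper [IsFiniteMeasure P] [IsFiniteMeasure Q]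
    (H : IsExtDensity P Q h) (hφ : Measurable φ)
    (H' : IsExtDensity (P.map φ) (Q.map φ) h') {A : Set β} (hA : MeasurableSet A) {b : ℝ}
    (hb0 : 0 ≤ b) (hPt : P {x | h x = ⊤} = 0) (hb : ∀ᵐ x ∂Q, (h x).toReal ≤ b)
    (hsub : ∀ x ∈ A, h' x ≠ ⊤ ∧ b ≤ (h' x).toReal) :
    divMeasure g κ (P.map φ) (Q.map φ) h' A ≤ divMeasure g κ P Q h (φ ⁻¹' A) := by
  have hK := hφ hA
  have hle : ∀ᵐ x ∂Q, h x ≤ ENNReal.ofReal b := by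
    filter_upwards [hb, measure_eq_zero_iff_ae_notMem.1 H.null] with x hx hx'
    exact (ENNReal.le_ofReal_iff_toReal_le hx' hb0).2 hx
  have hle' : ∀ x ∈ A, ENNReal.ofReal b ≤ h' x := fun x hx =>
    ENNReal.ofReal_le_of_le_toReal (hsub x hx).2
  have e : P (φ ⁻¹' A) = ∫⁻ x in φ ⁻¹' A, h x ∂Q := by
    rw [H.apply_eq _ hK, measure_mono_null inter_subset_right hPt, add_zero]
  have e' : P (φ ⁻¹' A) = ∫⁻ x in A, h' x ∂(Q.map φ) := by
    rw [← Measure.map_apply hφ hA, H'.apply_eq _ hA, show A ∩ {x | h' x = ⊤} = ∅ from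
      eq_empty_of_forall_notMem fun x hx => (hsub x hx.1).1 hx.2, measure_empty, add_zero]
  have c : ∫⁻ _ in φ ⁻¹' A, ENNReal.ofReal b ∂Q = ∫⁻ _ in A, ENNReal.ofReal b ∂(Q.map φ) := by
    rw [setLIntegral_const, setLIntegral_const, Measure.map_apply hφ hA]
  have l1 : ∫⁻ x in φ ⁻¹' A, h x ∂Q ≤ ∫⁻ _ in φ ⁻¹' A, ENNReal.ofReal b ∂Q :=
    lintegral_mono_ae (ae_restrict_of_ae hle)
  have l2 : ∫⁻ _ in A, ENNReal.ofReal b ∂(Q.map φ) ≤ ∫⁻ x in A, h' x ∂(Q.map φ) :=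
    setLIntegral_mono' hA hle'
  refine divMeasure_map_le_of_eq_const (c := ENNReal.ofReal b) hφ hA (fun x hx => (hsub x hx).1)
    ?_ ?_
  · refine ae_eq_of_ae_le_of_lintegral_le (ae_restrict_of_ae hle) ?_ aemeasurable_const ?_
    · rw [← e]
      finiteness
    · rw [c, ← e, e']
      exact l2
  · refine (ae_eq_of_ae_le_of_lintegral_le (ae_restrict_of_forall_mem hA hle') ?_
      H'.measurable.aemeasurable ?_).mono fun x hx => hx.symm
    · exact ne_top_of_le_ne_top (by rw [← e']; finiteness) l2
    · rw [← e', e, ← c]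
      exact l1

/-- The same closed chain with the inequalities reversed. A singular part of `P` need not be
excluded here, since `∫ h dQ ≤ P` is the direction required. -/
theorem IsExtDensity.divMeasure_map_le_of_lower [IsFiniteMeasure P] [IsFiniteMeasure Q]
    (H : IsExtDensity P Q h) (hφ : Measurable φ)
    (H' : IsExtDensity (P.map φ) (Q.map φ) h') {A : Set β} (hA : MeasurableSet A) {a : ℝ}
    (ha0 : 0 ≤ a) (ha : ∀ᵐ x ∂Q, a ≤ (h x).toReal)
    (hsub : ∀ x ∈ A, h' x ≠ ⊤ ∧ (h' x).toReal ≤ a) :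
    divMeasure g κ (P.map φ) (Q.map φ) h' A ≤ divMeasure g κ P Q h (φ ⁻¹' A) := by
  have hK := hφ hA
  have hle : ∀ᵐ x ∂Q, ENNReal.ofReal a ≤ h x := ha.mono fun x hx =>
    ENNReal.ofReal_le_of_le_toReal hx
  have hle' : ∀ x ∈ A, h' x ≤ ENNReal.ofReal a := fun x hx =>
    (ENNReal.le_ofReal_iff_toReal_le (hsub x hx).1 ha0).2 (hsub x hx).2
  have e : ∫⁻ x in φ ⁻¹' A, h x ∂Q ≤ P (φ ⁻¹' A) := by
    rw [H.apply_eq _ hK]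
    exact le_self_add
  have e' : P (φ ⁻¹' A) = ∫⁻ x in A, h' x ∂(Q.map φ) := by
    rw [← Measure.map_apply hφ hA, H'.apply_eq _ hA, show A ∩ {x | h' x = ⊤} = ∅ from
      eq_empty_of_forall_notMem fun x hx => (hsub x hx.1).1 hx.2, measure_empty, add_zero]
  have c : ∫⁻ _ in φ ⁻¹' A, ENNReal.ofReal a ∂Q = ∫⁻ _ in A, ENNReal.ofReal a ∂(Q.map φ) := by
    rw [setLIntegral_const, setLIntegral_const, Measure.map_apply hφ hA]
  have l1 : ∫⁻ _ in φ ⁻¹' A, ENNReal.ofReal a ∂Q ≤ ∫⁻ x in φ ⁻¹' A, h x ∂Q :=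
    lintegral_mono_ae (ae_restrict_of_ae hle)
  have l2 : ∫⁻ x in A, h' x ∂(Q.map φ) ≤ ∫⁻ _ in A, ENNReal.ofReal a ∂(Q.map φ) :=
    setLIntegral_mono' hA hle'
  refine divMeasure_map_le_of_eq_const (c := ENNReal.ofReal a) hφ hA (fun x hx => (hsub x hx).1)
    ?_ ?_
  · refine (ae_eq_of_ae_le_of_lintegral_le (ae_restrict_of_ae hle) ?_
      H.measurable.aemeasurable ?_).mono fun x hx => hx.symm
    · exact ne_top_of_le_ne_top (measure_ne_top P _) (l1.trans e)
    · rw [c]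
      exact e.trans (e'.le.trans l2)
  · refine ae_eq_of_ae_le_of_lintegral_le (ae_restrict_of_forall_mem hA hle') ?_
      aemeasurable_const ?_
    · rw [← e']
      finiteness
    · rw [← c, ← e']
      exact l1.trans e

/-- The data processing inequality for measurable maps. -/
theorem IsExtDensity.divMeasure_map_univ_le [IsFiniteMeasure P] [IsFiniteMeasure Q]
    (hg : IsNonnegGenerator g κ) (H : IsExtDensity P Q h) (hφ : Measurable φ)
    (H' : IsExtDensity (P.map φ) (Q.map φ) h') :
    divMeasure g κ (P.map φ) (Q.map φ) h' univ ≤ divMeasure g κ P Q h univ := by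
  by_cases hJ : divMeasure g κ P Q h univ = ⊤
  · rw [hJ]
    exact le_top
  set D : Set ℝ := {t | g t ≠ ⊤} with hD
  rw [divMeasure_apply _ _ _ _ _ .univ, Measure.restrict_univ, univ_inter] at hJ
  have hmt : Measurable fun x => (h' x).toReal := H'.measurable.ennreal_toReal
  -- A finite divergence confines `h` to the domain of `g`, `Q`-almost everywhere.
  have hgD : ∀ᵐ x ∂Q, (h x).toReal ∈ D :=
    (ae_lt_top (hg.measurable.comp H.measurable.ennreal_toReal) fun hi => hJ (by
      rw [show (∫⁻ x, g (h x).toReal ∂Q) = ⊤ from hi, top_add])).mono fun x hx => hx.ne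
  have hbelow : BddBelow D := ⟨0, hg.nonneg⟩
  have hfin : MeasurableSet {x | h' x ≠ ⊤} :=
    (H'.measurable (measurableSet_singleton ⊤)).compl
  have key : ∀ ε : ℝ, 0 < ε → divMeasure g κ (P.map φ) (Q.map φ) h' univ ≤
      divMeasure g κ P Q h univ + ENNReal.ofReal ε * Q univ := by
    intro ε hε
    choose! a b hab ha hO using hg.tangent
    choose! O hOs hOo hOt using fun t ht => mem_nhds_iff.1 (hO t ht ε hε)
    -- Lindelöf: countably many of the neighbourhoods on which a tangent line is `ε`-close to `g`
    -- cover the interior of the domain.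
    obtain ⟨T, hTD, hTc, hTU⟩ := TopologicalSpace.isOpen_biUnion_countable (interior D) O hOo
    -- The pieces: `h'` infinite, at or above the upper end of `D`, at or below its lower end, or
    -- near a chosen tangency point.
    have := measure_univ_le_of_sUnion (μ := divMeasure g κ (P.map φ) (Q.map φ) h')
      (ν := (divMeasure g κ P Q h).map φ + ENNReal.ofReal ε • Q.map φ)
      (S := {{x | h' x = ⊤}, {x | h' x ≠ ⊤} ∩ {x | BddAbove D ∧ sSup D ≤ (h' x).toReal},
        {x | h' x ≠ ⊤} ∩ {x | (h' x).toReal ≤ sInf D}} ∪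
          (fun t => {x | h' x ≠ ⊤} ∩ {x | (h' x).toReal ∈ O t}) '' T)
      ((by simp : Set.Countable _).union (hTc.image _)) ?_ ?_ ?_
    · rwa [Measure.add_apply, Measure.map_apply hφ .univ, Measure.smul_apply,
        Measure.map_apply hφ .univ, preimage_univ] at this
    · rintro B ((rfl | rfl | rfl) | ⟨t, ht, rfl⟩)
      · exact H'.measurable (measurableSet_singleton ⊤)
      · exact hfin.inter ((MeasurableSet.const _).inter (measurableSet_le measurable_const hmt))
      · exact hfin.inter (measurableSet_le hmt measurable_const)
      · exact hfin.inter (hmt (hOo t (hTD ht)).measurableSet)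
    · rintro B hB A hAB hA
      rw [Measure.add_apply, Measure.map_apply hφ hA, Measure.smul_apply, smul_eq_mul]
      rcases hB with ((rfl | rfl | rfl) | ⟨t, ht, rfl⟩)
      · exact le_add_right (H.divMeasure_map_le_of_top hφ H' hA hAB)
      · refine le_add_right ?_
        rcases A.eq_empty_or_nonempty with rfl | ⟨x, hx⟩
        · simp
        have hbdd : BddAbove D := (hAB hx).2.1
        obtain ⟨t, ht⟩ := hg.nonempty
        refine H.divMeasure_map_le_of_upper hφ H' hA ((hg.nonneg t ht).trans (le_csSup hbdd ht)) ?_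
          (hgD.mono fun x hx => le_csSup hbdd hx) fun x hx => ⟨(hAB hx).1, (hAB hx).2.2⟩
        -- A bounded domain forces `κ = ⊤`, so positive `P`-mass on `{h = ⊤}` would make the
        -- divergence infinite.
        by_contra h0
        rw [hg.slope_top hbdd, ENNReal.top_mul h0, add_top] at hJ
        exact hJ rfl
      · exact le_add_right (H.divMeasure_map_le_of_lower hφ H' hA
          (le_csInf hg.nonempty hg.nonneg) (hgD.mono fun x hx => csInf_le hbelow hx) hAB)
      · exact H.divMeasure_map_le_of_tangent hg.measurable hφ H' hA (hab t (hTD ht))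
          (ha t (hTD ht)) fun x hx => ⟨(hAB hx).1, hOs t (hTD ht) (hAB hx).2⟩
    · intro x
      by_cases hx : h' x = ⊤
      · exact ⟨_, .inl (.inl rfl), hx⟩
      by_cases hU : BddAbove D ∧ sSup D ≤ (h' x).toReal
      · exact ⟨_, .inl (.inr (.inl rfl)), hx, hU⟩
      by_cases hL : (h' x).toReal ≤ sInf D
      · exact ⟨_, .inl (.inr (.inr rfl)), hx, hL⟩
      obtain ⟨d, hd, hdx⟩ := exists_lt_of_csInf_lt hg.nonempty (not_le.1 hL)
      obtain ⟨e, he, hex⟩ : ∃ e ∈ D, (h' x).toReal < e := by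
        by_cases hbdd : BddAbove D
        · exact exists_lt_of_lt_csSup hg.nonempty (not_le.1 fun h => hU ⟨hbdd, h⟩)
        · simpa using not_bddAbove_iff.1 hbdd _
      have hint : (h' x).toReal ∈ interior D := mem_interior.2 ⟨Ioo d e,
        Ioo_subset_Icc_self.trans (hg.ordConnected.out hd he), isOpen_Ioo, hdx, hex⟩
      have : (h' x).toReal ∈ ⋃ t ∈ T, O t := by
        rw [hTU]
        exact mem_iUnion₂.2 ⟨_, hint, hOt _ hint⟩
      obtain ⟨t, ht, hxt⟩ := mem_iUnion₂.1 this
      exact ⟨_, .inr ⟨t, ht, rfl⟩, hx, hxt⟩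
  refine ENNReal.le_of_forall_pos_le_add fun δ hδ _ => ?_
  -- The `+ 1` keeps the denominator positive when `Q = 0`.
  have hQ : 0 < (Q univ).toReal + 1 := by positivity
  refine (key (δ / ((Q univ).toReal + 1)) (by positivity)).trans ?_
  gcongr
  calc _ ≤ ENNReal.ofReal (δ / ((Q univ).toReal + 1)) * ENNReal.ofReal ((Q univ).toReal + 1) := by
        gcongr
        rw [← ENNReal.ofReal_toReal (measure_ne_top Q univ)]
        exact ENNReal.ofReal_le_ofReal (by simp)
    _ = δ := by
        rw [← ENNReal.ofReal_mul (by positivity), div_mul_cancel₀ _ hQ.ne', ENNReal.ofReal_coe_nnreal]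

end DataProcessing

/-! ### Divergence generators as nonnegative generators -/

namespace IsDivergenceFunction

variable {f : ℝ → EReal}

theorem coe_toReal (hf : IsDivergenceFunction f) {t : ℝ} (ht : f t ≠ ⊤) :
    ((f t).toReal : EReal) = f t :=
  EReal.coe_toReal ht (hf.ne_bot t)

theorem convexOn_toReal (hf : IsDivergenceFunction f) :
    ConvexOn ℝ {t | f t ≠ ⊤} fun t => (f t).toReal := by
  have key : ∀ x, f x ≠ ⊤ → ∀ y, f y ≠ ⊤ → ∀ a b : ℝ, 0 ≤ a → 0 ≤ b → a + b = 1 →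
      f (a * x + b * y) ≤ ((a * (f x).toReal + b * (f y).toReal : ℝ) : EReal) := by
    intro x hx y hy a b ha hb hab
    obtain rfl : b = 1 - a := by linarith
    refine (hf.convex x y a ha (by linarith)).trans (le_of_eq ?_)
    rw [← hf.coe_toReal hx, ← hf.coe_toReal hy]
    push_cast
    simp
  refine ⟨fun x hx y hy a b ha hb hab => ?_, fun x hx y hy a b ha hb hab => ?_⟩
  · exact ne_top_of_le_ne_top (EReal.coe_ne_top _) (key x hx y hy a b ha hb hab)
  · have h := key x hx y hy a b ha hb hab
    rw [← EReal.coe_le_coe_iff]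
    simp only [smul_eq_mul]
    rwa [hf.coe_toReal (ne_top_of_le_ne_top (EReal.coe_ne_top _) h)]

theorem measurable (hf : IsDivergenceFunction f) : Measurable f := by
  refine measurable_of_Iic fun y => ?_
  induction y with
  | bot =>
    rw [show f ⁻¹' Iic ⊥ = ∅ from eq_empty_of_forall_notMem fun t ht => hf.ne_bot t (le_bot_iff.1 ht)]
    exact .empty
  | top => simp
  | coe r =>
    have : f ⁻¹' Iic (r : EReal) = {t ∈ {t | f t ≠ ⊤} | (f t).toReal ≤ r} := by
      ext t
      constructor
      · intro (h : f t ≤ r)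
        have ht : f t ≠ ⊤ := ne_top_of_le_ne_top (EReal.coe_ne_top _) h
        exact ⟨ht, by rwa [← EReal.coe_le_coe_iff, hf.coe_toReal ht]⟩
      · rintro ⟨ht, h⟩
        rwa [← EReal.coe_le_coe_iff, hf.coe_toReal ht] at h
    rw [this]
    exact (hf.convexOn_toReal.convex_le r).ordConnected.measurableSet

/-- The right derivative at an interior point lies between the slopes of the chords to its left and
to its right. -/
theorem exists_subgradient (hf : IsDivergenceFunction f) {t : ℝ} (ht : t ∈ interior {t | f t ≠ ⊤}) :
    ∃ a : ℝ, ∀ s, f s ≠ ⊤ → (f t).toReal + a * (s - t) ≤ (f s).toReal := by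
  have hc := hf.convexOn_toReal
  refine ⟨derivWithin (fun t => (f t).toReal) (Ioi t) t, fun s hs => ?_⟩
  rcases lt_trichotomy s t with h | rfl | h
  · have := (hc.slope_le_leftDeriv_of_mem_interior hs ht h).trans
      (hc.leftDeriv_le_rightDeriv_of_mem_interior ht)
    rw [slope_def_field, div_le_iff₀ (by linarith)] at this
    linarith
  · simp
  · have := hc.rightDeriv_le_slope_of_mem_interior ht hs h
    rw [slope_def_field, le_div_iff₀ (by linarith)] at this
    linarith

/-- A subgradient of the generator at `1`. -/
def slopeOne (hf : IsDivergenceFunction f) : ℝ :=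
  (hf.exists_subgradient hf.one_mem_interior).choose

theorem slopeOne_mul_le (hf : IsDivergenceFunction f) {s : ℝ} (hs : f s ≠ ⊤) :
    hf.slopeOne * (s - 1) ≤ (f s).toReal := by
  simpa [hf.map_one, slopeOne] using (hf.exists_subgradient hf.one_mem_interior).choose_spec s hs

/-- The generator minus its affine minorant at `1`. -/
def nonnegPart (hf : IsDivergenceFunction f) (t : ℝ) : ℝ≥0∞ :=
  (f t - ((hf.slopeOne * (t - 1) : ℝ) : EReal)).toENNReal

theorem nonnegPart_of_eq_top (hf : IsDivergenceFunction f) {t : ℝ} (ht : f t = ⊤) :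
    hf.nonnegPart t = ⊤ := by
  rw [nonnegPart, ht, EReal.top_sub_coe, EReal.toENNReal_top]

theorem nonnegPart_of_ne_top (hf : IsDivergenceFunction f) {t : ℝ} (ht : f t ≠ ⊤) :
    hf.nonnegPart t = ENNReal.ofReal ((f t).toReal - hf.slopeOne * (t - 1)) := by
  rw [nonnegPart]
  conv_lhs => rw [← hf.coe_toReal ht]
  rw [← EReal.coe_sub, EReal.toENNReal_of_ne_top (EReal.coe_ne_top _), EReal.toReal_coe]

theorem nonnegPart_eq_top_iff (hf : IsDivergenceFunction f) {t : ℝ} :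
    hf.nonnegPart t = ⊤ ↔ f t = ⊤ := by
  refine ⟨fun h => ?_, hf.nonnegPart_of_eq_top⟩
  by_contra ht
  rw [hf.nonnegPart_of_ne_top ht] at h
  exact ENNReal.ofReal_ne_top h

theorem eq_nonnegPart_add (hf : IsDivergenceFunction f) (t : ℝ) :
    f t = (hf.nonnegPart t : EReal) + ((hf.slopeOne * (t - 1) : ℝ) : EReal) := by
  by_cases ht : f t = ⊤
  · rw [hf.nonnegPart_of_eq_top ht, ht, EReal.coe_ennreal_top, EReal.top_add_coe]
  · rw [hf.nonnegPart_of_ne_top ht, EReal.coe_ennreal_ofReal,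
      max_eq_left (sub_nonneg.2 (hf.slopeOne_mul_le ht)), ← EReal.coe_add, sub_add_cancel,
      hf.coe_toReal ht]

theorem measurable_nonnegPart (hf : IsDivergenceFunction f) : Measurable hf.nonnegPart := by
  unfold nonnegPart
  have : Measurable fun t : ℝ => ((hf.slopeOne * (t - 1) : ℝ) : EReal) :=
    measurable_coe_real_ereal.comp (by fun_prop)
  exact (hf.measurable.sub this).ereal_toENNReal

/-- The value at `0` of the conjugate of `nonnegPart`. -/
def nonnegConj (hf : IsDivergenceFunction f) : ℝ≥0∞ :=
  ⨆ s ∈ Ioi (1 : ℝ), hf.nonnegPart s / ENNReal.ofReal (s - 1)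

theorem le_nonnegConj (hf : IsDivergenceFunction f) {s : ℝ} (hs : 1 < s) :
    hf.nonnegPart s / ENNReal.ofReal (s - 1) ≤ hf.nonnegConj :=
  le_iSup₂_of_le s hs le_rfl

theorem isNonnegGenerator (hf : IsDivergenceFunction f) :
    IsNonnegGenerator hf.nonnegPart hf.nonnegConj := by
  have hD : {t | hf.nonnegPart t ≠ ⊤} = {t | f t ≠ ⊤} := by
    ext t
    exact hf.nonnegPart_eq_top_iff.not
  refine ⟨hf.measurable_nonnegPart, ?_, ?_, ⟨1, ?_⟩, ?_, ?_⟩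
  · rw [hD]
    exact hf.convexOn_toReal.1.ordConnected
  · intro t ht
    by_contra h
    exact ht (hf.nonnegPart_of_eq_top (hf.eq_top_of_neg t (not_le.1 h)))
  · rw [Ne, hf.nonnegPart_eq_top_iff, hf.map_one]
    exact EReal.zero_ne_top
  · rw [hD]
    intro t ht
    obtain ⟨a, ha⟩ := hf.exists_subgradient ht
    set c := hf.slopeOne with hc
    -- The line `(a - c) * s + b` is the tangent to `nonnegPart` at `t`: the subgradient of `f` is
    -- shifted by the slope `c` of the subtracted line.
    set b := (f t).toReal - c * (t - 1) - (a - c) * t with hb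
    have hmin : ∀ s, ENNReal.ofReal ((a - c) * s + b) ≤ hf.nonnegPart s := by
      intro s
      by_cases hs : f s = ⊤
      · rw [hf.nonnegPart_of_eq_top hs]
        exact le_top
      · rw [hf.nonnegPart_of_ne_top hs]
        refine ENNReal.ofReal_le_ofReal ?_
        have := ha s hs
        rw [hb, ← hc]
        linarith
    refine ⟨a - c, b, hmin, ?_, ?_⟩
    -- Dividing the minorant by `s - 1` and letting `s → ∞` isolates its slope, which is therefore
    -- at most the supremum `nonnegConj`.
    · have hlim : Tendsto (fun s : ℝ => ENNReal.ofReal ((a - c) + (a - c + b) / (s - 1))) atTop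
          (𝓝 (ENNReal.ofReal (a - c + 0))) := by
        refine ENNReal.tendsto_ofReal (tendsto_const_nhds.add ?_)
        exact tendsto_const_nhds.div_atTop (tendsto_atTop_add_const_right _ _ tendsto_id)
      rw [add_zero] at hlim
      refine le_of_tendsto hlim ?_
      filter_upwards [eventually_gt_atTop 1] with s hs
      have hs' : 0 < s - 1 := by linarith
      refine le_trans ?_ (hf.le_nonnegConj hs)
      rw [show (a - c) + (a - c + b) / (s - 1) = ((a - c) * s + b) / (s - 1) by field_simp; ring,
        ENNReal.ofReal_div_of_pos hs']
      exact ENNReal.div_le_div_right (hmin s) _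
    · intro ε hε
      have hcont : ContinuousAt (fun s => (f s).toReal) t :=
        hf.convexOn_toReal.continuousOn_interior.continuousAt (isOpen_interior.mem_nhds ht)
      have hcont' : ContinuousAt
          (fun s => (f s).toReal - c * (s - 1) - ((a - c) * s + b)) t := by fun_prop
      have hlt : (f t).toReal - c * (t - 1) - ((a - c) * t + b) < ε := by
        rw [hb]
        linarith
      filter_upwards [hcont'.eventually_lt_const hlt,
        mem_interior_iff_mem_nhds.1 ht] with s hs hs'
      refine ⟨hf.nonnegPart_eq_top_iff.not.2 hs', ?_⟩
      rw [hf.nonnegPart_of_ne_top hs', ENNReal.toReal_ofReal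
        (sub_nonneg.2 (hf.slopeOne_mul_le hs')), ← hc]
      linarith
  · rw [hD]
    rintro ⟨M, hM⟩
    -- One point beyond the domain and above `1` already makes a quotient in the supremum infinite.
    have hs : (1 : ℝ) < max M 1 + 1 := by linarith [le_max_right M 1]
    have hft : f (max M 1 + 1) = ⊤ := by
      by_contra h
      linarith [hM h, le_max_left M 1]
    have := hf.le_nonnegConj hs
    rw [hf.nonnegPart_of_eq_top hft, ENNReal.top_div_of_ne_top ENNReal.ofReal_ne_top] at this
    exact top_le_iff.1 this

/-- As `nonnegPart` vanishes at `1`, these are chord slopes from `1`, monotone by convexity. Hence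
the supremum `nonnegConj` is a limit at infinity. -/
theorem nonnegPart_div_mono (hf : IsDivergenceFunction f) {s u : ℝ} (hs : 1 < s) (hsu : s ≤ u) :
    hf.nonnegPart s / ENNReal.ofReal (s - 1) ≤ hf.nonnegPart u / ENNReal.ofReal (u - 1) := by
  by_cases hu : f u = ⊤
  · rw [hf.nonnegPart_of_eq_top hu, ENNReal.top_div_of_ne_top ENNReal.ofReal_ne_top]
    exact le_top
  have h1 : f 1 ≠ ⊤ := by
    rw [hf.map_one]
    exact EReal.zero_ne_top
  have hs' : f s ≠ ⊤ := hf.convexOn_toReal.1.ordConnected.out h1 hu ⟨hs.le, hsu⟩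
  have hsec := hf.convexOn_toReal.secant_mono h1 hs' hu hs.ne' (hs.trans_le hsu).ne' hsu
  have p1 : 0 < s - 1 := by linarith
  have p2 : 0 < u - 1 := by linarith
  rw [hf.nonnegPart_of_ne_top hs', hf.nonnegPart_of_ne_top hu, ← ENNReal.ofReal_div_of_pos p1,
    ← ENNReal.ofReal_div_of_pos p2]
  refine ENNReal.ofReal_le_ofReal ?_
  rw [sub_div, sub_div, mul_div_cancel_right₀ _ p1.ne', mul_div_cancel_right₀ _ p2.ne']
  simpa [hf.map_one] using hsec

/-- With `g` the nonnegative part and `c` the slope, `t * f (1 / t) = (1 - t) * (g (1 / t) / (1 / t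
- 1)) + c * (1 - t)` for `0 < t < 1`, and the quotient increases to `nonnegConj` as `t` decreases to
`0`. -/
theorem conjAtZero_eq (hf : IsDivergenceFunction f) :
    conjAtZero f = (hf.nonnegConj : EReal) + (hf.slopeOne : EReal) := by
  refine Tendsto.limUnder_eq ?_
  have h1 : Tendsto (fun t : ℝ => hf.nonnegPart (1 / t) / ENNReal.ofReal (1 / t - 1)) (𝓝[>] 0)
      (𝓝 hf.nonnegConj) := by
    have hev : ∀ᶠ t : ℝ in 𝓝[>] 0, 1 < 1 / t := by
      simp only [one_div]
      exact tendsto_inv_nhdsGT_zero.eventually_gt_atTop 1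
    refine tendsto_order.2 ⟨fun y hy => ?_, fun y hy => ?_⟩
    · obtain ⟨s, hs⟩ := lt_iSup_iff.1 hy
      obtain ⟨hs1, hs⟩ := lt_iSup_iff.1 hs
      have hev' : ∀ᶠ t : ℝ in 𝓝[>] 0, s ≤ 1 / t := by
        simp only [one_div]
        exact tendsto_inv_nhdsGT_zero.eventually_ge_atTop s
      filter_upwards [hev'] with t ht
      exact hs.trans_le (hf.nonnegPart_div_mono hs1 ht)
    · filter_upwards [hev] with t ht
      exact (hf.le_nonnegConj ht).trans_lt hy
  have h2 : Tendsto (fun t : ℝ => 1 - t) (𝓝[>] 0) (𝓝 1) := by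
    have : Tendsto (fun t : ℝ => 1 - t) (𝓝 0) (𝓝 (1 - 0)) := tendsto_const_nhds.sub tendsto_id
    rw [sub_zero] at this
    exact this.mono_left nhdsWithin_le_nhds
  have h3 := ENNReal.Tendsto.mul (ENNReal.tendsto_ofReal h2) (.inl (by simp)) h1
    (.inr ENNReal.ofReal_ne_top)
  rw [ENNReal.ofReal_one, one_mul] at h3
  have h4 : Tendsto (fun t : ℝ => ((hf.slopeOne * (1 - t) : ℝ) : EReal)) (𝓝[>] 0)
      (𝓝 (hf.slopeOne : EReal)) := by
    have := h2.const_mul hf.slopeOne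
    rw [mul_one] at this
    exact EReal.tendsto_coe.2 this
  have h5 := (EReal.continuousAt_add (p := ((hf.nonnegConj : EReal), (hf.slopeOne : EReal)))
    (.inr (EReal.coe_ne_bot _)) (.inr (EReal.coe_ne_top _))).tendsto.comp
    ((EReal.tendsto_coe_ennreal.2 h3).prodMk_nhds h4)
  refine h5.congr' ?_
  filter_upwards [Ioo_mem_nhdsGT (zero_lt_one (α := ℝ))] with t ht
  obtain ⟨ht0, ht1⟩ := ht
  have hs : 0 < 1 / t - 1 := by
    rw [sub_pos]
    exact one_lt_one_div ht0 ht1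
  have e1 : ENNReal.ofReal (1 - t) = ENNReal.ofReal t * ENNReal.ofReal (1 / t - 1) := by
    rw [← ENNReal.ofReal_mul ht0.le]
    congr 1
    field_simp
  have e2 : ENNReal.ofReal (1 - t) * (hf.nonnegPart (1 / t) / ENNReal.ofReal (1 / t - 1))
      = ENNReal.ofReal t * hf.nonnegPart (1 / t) := by
    rw [e1, mul_assoc, ENNReal.mul_div_cancel (by simpa using hs) ENNReal.ofReal_ne_top]
  simp only [Function.comp_apply]
  rw [e2, hf.eq_nonnegPart_add (1 / t), EReal.left_distrib_of_nonneg_of_ne_top (x := (t : EReal))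
    (by exact_mod_cast ht0.le) (EReal.coe_ne_top _), EReal.coe_ennreal_mul,
    EReal.coe_ennreal_ofReal, max_eq_left ht0.le, ← EReal.coe_mul]
  congr 2
  field_simp

end IsDivergenceFunction

/-! ### Divergences as total masses, and data processing for them -/

/-- Integrate the pointwise identity `(G + k)⁺ + k⁻ = (G + k)⁻ + G + k⁺`; the terms to be subtracted
are finite because `(G + k)⁻ ≤ k⁻`. -/
theorem integralEReal_add_coe {α : Type*} [MeasurableSpace α] {μ : Measure α} {G : α → ℝ≥0∞}
    (hG : Measurable G) {k : α → ℝ} (hk : Measurable k) (hki : Integrable k μ) :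
    integralEReal μ (fun x => (G x : EReal) + (k x : EReal)) =
      ((∫⁻ x, G x ∂μ : ℝ≥0∞) : EReal) + ((∫ x, k x ∂μ : ℝ) : EReal) := by
  have hsum : Measurable fun x => (G x : EReal) + (k x : EReal) :=
    (measurable_coe_ennreal_ereal.comp hG).add (measurable_coe_real_ereal.comp hk)
  have hpt : ∀ x, ((G x : EReal) + (k x : EReal)).toENNReal + ENNReal.ofReal (-k x) =
      (-((G x : EReal) + (k x : EReal))).toENNReal + (G x + ENNReal.ofReal (k x)) := by
    intro x
    induction G x with
    | top => simp
    | coe r =>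
      rw [EReal.coe_nnreal_eq_coe_real r, ← EReal.coe_add, ← EReal.coe_neg,
        EReal.real_coe_toENNReal, EReal.real_coe_toENNReal]
      simp only [ENNReal.ofReal]
      norm_cast
      rw [← NNReal.coe_inj]
      push_cast
      simp only [Real.coe_toNNReal']
      grind
  have hint := lintegral_congr (μ := μ) hpt
  rw [lintegral_add_left hsum.ereal_toENNReal, lintegral_add_left
      (f := fun x => (-((G x : EReal) + (k x : EReal))).toENNReal) hsum.neg.ereal_toENNReal,
    lintegral_add_left hG] at hint
  have hn : ∫⁻ x, ENNReal.ofReal (-k x) ∂μ ≠ ⊤ := hki.neg.lintegral_lt_top.ne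
  have hp : ∫⁻ x, ENNReal.ofReal (k x) ∂μ ≠ ⊤ := hki.lintegral_lt_top.ne
  have hv : ∫⁻ x, (-((G x : EReal) + (k x : EReal))).toENNReal ∂μ ≠ ⊤ := by
    refine ne_top_of_le_ne_top hn (lintegral_mono fun x => ?_)
    rw [← EReal.real_coe_toENNReal, EReal.coe_neg]
    refine EReal.toENNReal_le_toENNReal (EReal.neg_le_neg_iff.2 ?_)
    exact le_add_of_nonneg_left (EReal.coe_ennreal_nonneg _)
  rw [integralEReal, integral_eq_lintegral_pos_part_sub_lintegral_neg_part hki]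
  generalize ∫⁻ x, ((G x : EReal) + (k x : EReal)).toENNReal ∂μ = a at *
  generalize ∫⁻ x, (-((G x : EReal) + (k x : EReal))).toENNReal ∂μ = b at *
  generalize ∫⁻ x, G x ∂μ = c at *
  generalize ∫⁻ x, ENNReal.ofReal (-k x) ∂μ = d at *
  generalize ∫⁻ x, ENNReal.ofReal (k x) ∂μ = e at *
  lift b to NNReal using hv
  lift d to NNReal using hn
  lift e to NNReal using hp
  induction c with
  | top =>
    have : a = ⊤ := by simpa using hint
    rw [this, EReal.coe_nnreal_eq_coe_real, EReal.coe_ennreal_top, EReal.top_sub_coe,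
      EReal.top_add_coe]
  | coe r =>
    have ha : a ≠ ⊤ := by
      rintro rfl
      rw [top_add] at hint
      exact (by finiteness : (b : ℝ≥0∞) + (r + e) ≠ ⊤) hint.symm
    lift a to NNReal using ha
    norm_cast at hint
    rw [← NNReal.coe_inj] at hint
    push_cast at hint
    simp only [EReal.coe_nnreal_eq_coe_real, ENNReal.coe_toReal]
    rw [← EReal.coe_sub, ← EReal.coe_add]
    congr 1
    linarith

/-- The affine part `c * (h - 1)` integrates to `-c * P {h = ⊤}`, since `P` and `Q` both have mass
one. This cancels the summand `c` of `conjAtZero f`. -/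
theorem IsDivergenceFunction.integral_add_conjAtZero_eq {f : ℝ → EReal}
    (hf : IsDivergenceFunction f) {α : Type*} [MeasurableSpace α] {P Q : Measure α}
    [IsProbabilityMeasure P] [IsProbabilityMeasure Q] {h : α → ℝ≥0∞} (H : IsExtDensity P Q h) :
    integralEReal Q (fun x => f (h x).toReal)
        + conjAtZero f * ((P {x | h x = ⊤} : ℝ≥0∞) : EReal) =
      (divMeasure hf.nonnegPart hf.nonnegConj P Q h univ : EReal) := by
  have hm := H.measurable.ennreal_toReal
  have htot := H.apply_eq univ .univ
  rw [measure_univ, Measure.restrict_univ, univ_inter] at htot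
  have hfin : ∫⁻ x, h x ∂Q ≠ ⊤ := ne_top_of_le_ne_top ENNReal.one_ne_top (htot ▸ le_self_add)
  have hhi : Integrable (fun x => (h x).toReal) Q :=
    integrable_toReal_of_lintegral_ne_top H.measurable.aemeasurable hfin
  have hk : Integrable (fun x => hf.slopeOne * ((h x).toReal - 1)) Q :=
    (hhi.sub (integrable_const 1)).const_mul _
  have hkint : ∫ x, hf.slopeOne * ((h x).toReal - 1) ∂Q
      = - (hf.slopeOne * (P {x | h x = ⊤}).toReal) := by
    have hP : (P {x | h x = ⊤}) ≠ ⊤ := measure_ne_top _ _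
    have h1 : (∫⁻ x, h x ∂Q).toReal + (P {x | h x = ⊤}).toReal = 1 := by
      rw [← ENNReal.toReal_add hfin hP, ← htot, ENNReal.toReal_one]
    rw [integral_const_mul, integral_sub hhi (integrable_const 1), integral_const,
      integral_toReal H.measurable.aemeasurable (ae_lt_top H.measurable hfin)]
    simp only [probReal_univ, smul_eq_mul, one_mul]
    rw [show (∫⁻ x, h x ∂Q).toReal = 1 - (P {x | h x = ⊤}).toReal by linarith]
    ring
  rw [divMeasure_apply _ _ _ _ _ .univ, Measure.restrict_univ, univ_inter, hf.conjAtZero_eq]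
  simp_rw [hf.eq_nonnegPart_add]
  rw [integralEReal_add_coe (G := fun x => hf.nonnegPart (h x).toReal)
    (hf.measurable_nonnegPart.comp hm) ((hm.sub_const 1).const_mul _) hk,
    hkint]
  generalize ∫⁻ x, hf.nonnegPart (h x).toReal ∂Q = J
  have hP : P {x | h x = ⊤} ≠ ⊤ := measure_ne_top _ _
  generalize P {x | h x = ⊤} = p at *
  lift p to NNReal using hP
  generalize hf.slopeOne = c
  generalize hf.nonnegConj = κ
  rw [EReal.coe_ennreal_add, EReal.coe_ennreal_mul, ENNReal.coe_toReal,
    EReal.coe_nnreal_eq_coe_real]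
  induction κ with
  | top =>
    rw [EReal.coe_ennreal_top, EReal.top_add_coe]
    rcases eq_or_ne p 0 with rfl | hp
    · simp
    · rw [EReal.top_mul_coe_of_pos (by positivity)]
      rw [EReal.add_top_of_ne_bot, EReal.add_top_of_ne_bot (EReal.coe_ennreal_ne_bot _)]
      rw [Ne, EReal.add_eq_bot_iff, not_or]
      exact ⟨EReal.coe_ennreal_ne_bot _, EReal.coe_ne_bot _⟩
  | coe κ =>
    rw [EReal.coe_nnreal_eq_coe_real, ← EReal.coe_add, ← EReal.coe_mul, ← EReal.coe_mul, add_assoc,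
      ← EReal.coe_add]
    congr 2
    ring

theorem IsDivergenceFunction.fDivergence_eq {f : ℝ → EReal} (hf : IsDivergenceFunction f)
    {α : Type*} [MeasurableSpace α] (P Q : Measure α) [IsProbabilityMeasure P]
    [IsProbabilityMeasure Q] :
    fDivergence f P Q = divMeasure hf.nonnegPart hf.nonnegConj P Q (extDensity P Q) univ :=
  hf.integral_add_conjAtZero_eq (isExtDensity_extDensity P Q)

/-- The data processing inequality: a divergence does not increase under a measurable map. -/
theorem IsDivergenceFunction.fDivergence_map_le {f : ℝ → EReal} (hf : IsDivergenceFunction f)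
    {α β : Type*} [MeasurableSpace α] [MeasurableSpace β] (P Q : Measure α) [IsProbabilityMeasure P]
    [IsProbabilityMeasure Q] {φ : α → β} (hφ : Measurable φ) :
    fDivergence f (P.map φ) (Q.map φ) ≤ fDivergence f P Q := by
  have := Measure.isProbabilityMeasure_map (μ := P) hφ.aemeasurable
  have := Measure.isProbabilityMeasure_map (μ := Q) hφ.aemeasurable
  rw [hf.fDivergence_eq, hf.fDivergence_eq, EReal.coe_ennreal_le_coe_ennreal_iff]
  exact (isExtDensity_extDensity P Q).divMeasure_map_univ_le hf.isNonnegGenerator hφ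
    (isExtDensity_extDensity _ _)

/-- The data processing inequality for a measurable map with an independent random input. -/
theorem IsDivergenceFunction.fDivergence_map_prod_le {f : ℝ → EReal} (hf : IsDivergenceFunction f)
    {α β γ : Type*} [MeasurableSpace α] [MeasurableSpace β] [MeasurableSpace γ] (P Q : Measure α)
    [IsProbabilityMeasure P] [IsProbabilityMeasure Q] (R : Measure β) [IsProbabilityMeasure R]
    {φ : α × β → γ} (hφ : Measurable φ) :
    fDivergence f ((P.prod R).map φ) ((Q.prod R).map φ) ≤ fDivergence f P Q := by
  have := Measure.isProbabilityMeasure_map (μ := P.prod R) hφ.aemeasurable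
  have := Measure.isProbabilityMeasure_map (μ := Q.prod R) hφ.aemeasurable
  have H := isExtDensity_extDensity P Q
  rw [hf.fDivergence_eq, hf.fDivergence_eq, EReal.coe_ennreal_le_coe_ennreal_iff]
  -- After data processing it remains to integrate out the noise, on which the density does not
  -- depend.
  refine ((H.comp_fst R).divMeasure_map_univ_le hf.isNonnegGenerator hφ
    (isExtDensity_extDensity _ _)).trans (le_of_eq ?_)
  have hT : MeasurableSet {x | extDensity P Q x = ⊤} := H.measurable (measurableSet_singleton _)
  have hs : {x : α × β | extDensity P Q x.1 = ⊤} = {x | extDensity P Q x = ⊤} ×ˢ univ := by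
    ext
    simp
  have hm : Measurable fun x => hf.nonnegPart (extDensity P Q x).toReal :=
    hf.measurable_nonnegPart.comp H.measurable.ennreal_toReal
  rw [divMeasure_apply _ _ _ _ _ .univ, divMeasure_apply _ _ _ _ _ .univ, univ_inter, univ_inter,
    hs, Measure.prod_prod, measure_univ, mul_one, Measure.restrict_univ, Measure.restrict_univ,
    lintegral_prod (fun x : α × β => hf.nonnegPart (extDensity P Q x.1).toReal)
      (hm.comp measurable_fst).aemeasurable]
  simp

/-! ### Distributions on `ℝ^ι` and the uniform distribution -/

theorem measure_eq_of_orthants {ι : Type*} [Finite ι] {μ ν : Measure (ι → ℝ)}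
    [IsProbabilityMeasure μ] [IsProbabilityMeasure ν]
    (h : ∀ z : ι → ℝ, μ {w | ∀ i, w i ≤ z i} = ν {w | ∀ i, w i ≤ z i}) : μ = ν := by
  have hgen : (MeasurableSpace.pi : MeasurableSpace (ι → ℝ)) =
      MeasurableSpace.generateFrom (Set.pi univ '' Set.pi univ fun _ : ι => range (Iic (α := ℝ))) := by
    rw [← generateFrom_pi_eq]
    · congr 1
      funext i
      exact (BorelSpace.measurable_eq (α := ℝ)).trans (borel_eq_generateFrom_Iic ℝ)
    · intro i
      refine ⟨fun n => Iic (n : ℝ), fun n => mem_range_self _, ?_⟩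
      exact iUnion_eq_univ_iff.2 fun x => exists_nat_ge x
  refine ext_of_generate_finite _ hgen (IsPiSystem.pi fun _ => isPiSystem_Iic) ?_ (by simp)
  rintro s ⟨t, ht, rfl⟩
  choose z hz using fun i => ht i (mem_univ i)
  have : Set.pi univ t = {w | ∀ i, w i ≤ z i} := by
    ext w
    simp [← hz]
  rw [this, h]

theorem measurableSet_orthant {ι : Type*} [Finite ι] (z : ι → ℝ) :
    MeasurableSet {w : ι → ℝ | ∀ i, w i ≤ z i} := by
  simp only [ofPred_forall]
  exact .iInter fun i => measurableSet_le (measurable_pi_apply i) measurable_const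

instance : IsProbabilityMeasure uniformUnit :=
  ⟨by simp [uniformUnit]⟩

theorem uniformUnit_Iic {u : ℝ} (h1 : u ≤ 1) :
    uniformUnit (Iic u) = ENNReal.ofReal u := by
  have : Iic u ∩ Icc (0 : ℝ) 1 = Icc 0 u := by
    ext x
    simp only [mem_inter_iff, mem_Iic, mem_Icc]
    grind
  rw [uniformUnit, Measure.restrict_apply measurableSet_Iic, this, Real.volume_Icc, sub_zero]

theorem ae_uniformUnit_mem_Ioo : ∀ᵐ x ∂uniformUnit, x ∈ Ioo (0 : ℝ) 1 := by
  rw [uniformUnit, restrict_Ioo_eq_restrict_Icc.symm]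
  exact ae_restrict_mem measurableSet_Ioo

/-- The form is adapted to an event of probability `u` lying between `{U < u}` and `{U ≤ u}`, which
avoids checking separately that `U` has no atoms. -/
theorem eq_uniformUnit {M : Measure ℝ} [IsProbabilityMeasure M]
    (h : ∀ u ∈ Ioo (0 : ℝ) 1, M (Iio u) ≤ ENNReal.ofReal u ∧ ENNReal.ofReal u ≤ M (Iic u)) :
    M = uniformUnit := by
  have key : ∀ u ∈ Ico (0 : ℝ) 1, M (Iic u) ≤ ENNReal.ofReal u := by
    intro u hu
    refine ENNReal.le_of_forall_pos_le_add fun ε hε _ => ?_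
    -- A point above `u` and below `1`, within `ε` of `u`.
    set v := min (u + ε) ((u + 1) / 2) with hv
    have huv : u < v := lt_min (by simpa using hε) (by linarith [hu.2])
    have hv1 : v < 1 := (min_le_right _ _).trans_lt (by linarith [hu.2])
    calc M (Iic u) ≤ M (Iio v) := measure_mono fun x hx => (mem_Iic.1 hx).trans_lt huv
      _ ≤ ENNReal.ofReal v := (h v ⟨hu.1.trans_lt huv, hv1⟩).1
      _ ≤ ENNReal.ofReal (u + ε) := ENNReal.ofReal_le_ofReal (min_le_left _ _)
      _ ≤ _ := ENNReal.ofReal_add_le.trans (by simp)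
  refine Measure.ext_of_Iic _ _ fun u => ?_
  rcases lt_or_ge u 0 with h0 | h0
  · have hz : ∀ ρ : Measure ℝ, ρ (Iic 0) = 0 → ρ (Iic u) = 0 := fun ρ hρ =>
      measure_mono_null (Iic_subset_Iic.2 h0.le) hρ
    rw [hz M (by simpa using key 0 (by simp)),
      hz uniformUnit (by rw [uniformUnit_Iic zero_le_one, ENNReal.ofReal_zero])]
  rcases lt_or_ge u 1 with h1 | h1
  · rw [uniformUnit_Iic h1.le]
    rcases h0.eq_or_lt with rfl | h0
    · simpa using key 0 (by simp)
    · exact le_antisymm (key u ⟨h0.le, h1⟩) (h u ⟨h0, h1⟩).2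
  · have hz : ∀ ρ : Measure ℝ, IsProbabilityMeasure ρ →
        (∀ v ∈ Ioo (0 : ℝ) 1, ENNReal.ofReal v ≤ ρ (Iic v)) → ρ (Iic u) = 1 := by
      intro ρ hρ hv
      refine le_antisymm prob_le_one (ENNReal.le_of_forall_pos_le_add fun ε hε _ => ?_)
      set v := max (1 - (ε : ℝ)) (1 / 2) with hv'
      have hv1 : v < 1 := max_lt (by simpa using hε) (by norm_num)
      have hv0 : 0 < v := lt_max_of_lt_right (by norm_num)
      calc (1 : ℝ≥0∞) = ENNReal.ofReal 1 := ENNReal.ofReal_one.symm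
        _ ≤ ENNReal.ofReal (v + ε) := ENNReal.ofReal_le_ofReal (by
          linarith [le_max_left (1 - (ε : ℝ)) (1 / 2)])
        _ ≤ ENNReal.ofReal v + ε := ENNReal.ofReal_add_le.trans (by simp)
        _ ≤ _ := by
          gcongr
          exact (hv v ⟨hv0, hv1⟩).trans (measure_mono (Iic_subset_Iic.2 (hv1.le.trans h1)))
    rw [hz M inferInstance fun v hv => (h v hv).2, hz uniformUnit inferInstance fun v hv =>
      (uniformUnit_Iic hv.2.le).ge]

theorem HasUniformMarginals.ae_mem_Ioo {ι : Type*} [Finite ι] {μ : Measure (ι → ℝ)}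
    (h : HasUniformMarginals μ) : ∀ᵐ w ∂μ, ∀ i, w i ∈ Ioo (0 : ℝ) 1 := by
  rw [ae_all_iff]
  intro i
  have h1 := ae_uniformUnit_mem_Ioo
  rw [← h.2 i] at h1
  exact ae_of_ae_map (measurable_pi_apply i).aemeasurable h1

/-! ### The quantile transform -/

/-- The quantile function of `ρ`, extended by `0` outside `(0, 1)`. -/
def quantile (ρ : Measure ℝ) (u : ℝ) : ℝ :=
  (Ioo (0 : ℝ) 1).indicator (fun u => sInf {z | u ≤ cdf ρ z}) u

/-- For `u` in `(0, 1)` the set in the infimum is nonempty and bounded below, and right continuity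
of the cdf makes the infimum a minimum. -/
theorem quantile_le_iff (ρ : Measure ℝ) {u z : ℝ} (hu : u ∈ Ioo (0 : ℝ) 1) :
    quantile ρ u ≤ z ↔ u ≤ cdf ρ z := by
  rw [quantile, indicator_of_mem hu]
  have hne : {z | u ≤ cdf ρ z}.Nonempty :=
    ((tendsto_cdf_atTop ρ).eventually_const_le hu.2).exists
  have hbdd : BddBelow {z | u ≤ cdf ρ z} := by
    obtain ⟨z₀, hz₀⟩ := ((tendsto_cdf_atBot ρ).eventually_lt_const hu.1).exists
    refine ⟨z₀, fun z hz => ?_⟩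
    by_contra hlt
    exact (hz.trans (monotone_cdf ρ (not_le.1 hlt).le)).not_gt hz₀
  refine ⟨fun h => ?_, fun h => csInf_le hbdd h⟩
  have hr : Tendsto (cdf ρ) (𝓝[>] z) (𝓝 (cdf ρ z)) :=
    ((cdf ρ).right_continuous z).mono_left (nhdsWithin_mono _ Ioi_subset_Ici_self)
  refine ge_of_tendsto hr ?_
  filter_upwards [self_mem_nhdsWithin] with y hy
  obtain ⟨x, hx, hxy⟩ := exists_lt_of_csInf_lt hne (h.trans_lt hy)
  exact hx.trans (monotone_cdf ρ hxy.le)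

theorem measurable_quantile (ρ : Measure ℝ) : Measurable (quantile ρ) := by
  refine measurable_of_Iic fun z => ?_
  have : quantile ρ ⁻¹' Iic z = (Ioo 0 1 ∩ Iic (cdf ρ z)) ∪ ((Ioo 0 1)ᶜ ∩ {_u | 0 ≤ z}) := by
    ext u
    by_cases hu : u ∈ Ioo (0 : ℝ) 1
    · simp only [mem_preimage, mem_Iic, quantile_le_iff ρ hu, mem_union, mem_inter_iff, hu,
        mem_compl_iff, true_and, not_true_eq_false, false_and, or_false]
    · simp only [mem_preimage, mem_Iic, quantile, indicator_of_notMem hu, mem_union, mem_inter_iff,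
        hu, mem_compl_iff, false_and, not_false_eq_true, true_and, false_or, mem_ofPred_eq]
  rw [this]
  exact (measurableSet_Ioo.inter measurableSet_Iic).union
    (measurableSet_Ioo.compl.inter (.const _))

/-- The quantile transform of a vector distributed according to a copula for `Z` has the law of
`Z`. -/
theorem IsCopulaFor.map_quantile {Ω ι : Type*} [Finite ι] [MeasurableSpace Ω] {P : Measure Ω}
    [IsProbabilityMeasure P] {Z : Ω → ι → ℝ} (hZ : Measurable Z) {μ : Measure (ι → ℝ)}
    (hμ : HasUniformMarginals μ) (hC : IsCopulaFor P Z (cubeCdf μ)) :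
    (μ.map fun w i => quantile (P.map fun ω => Z ω i) (w i)) = P.map Z := by
  have := hμ.1
  have hq : Measurable fun (w : ι → ℝ) i => quantile (P.map fun ω => Z ω i) (w i) :=
    measurable_pi_lambda _ fun i => (measurable_quantile _).comp (measurable_pi_apply i)
  have := Measure.isProbabilityMeasure_map (μ := μ) hq.aemeasurable
  have := Measure.isProbabilityMeasure_map (μ := P) hZ.aemeasurable
  refine measure_eq_of_orthants fun z => ?_
  have h := hC.2 z
  simp only [cubeCdf, jointCdf, Measure.real] at h
  rw [ENNReal.toReal_eq_toReal_iff' (measure_ne_top _ _) (measure_ne_top _ _)] at h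
  rw [h, Measure.map_apply hq (measurableSet_orthant z)]
  refine measure_congr ?_
  -- Almost surely all coordinates lie in `(0, 1)`, where `quantile_le_iff` turns the orthant at `z`
  -- into the one at the cdf values.
  filter_upwards [hμ.ae_mem_Ioo] with w hw
  exact propext (forall_congr' fun i => quantile_le_iff _ (hw i))

/-! ### Marginals and products of copulas -/

theorem measurable_sumElim {ι κ : Type*} :
    Measurable fun p : (ι → ℝ) × (κ → ℝ) => (Sum.elim p.1 p.2 : ι ⊕ κ → ℝ) := by
  refine measurable_pi_lambda _ fun i => ?_
  rcases i with i | i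
  · exact (measurable_pi_apply i).comp measurable_fst
  · exact (measurable_pi_apply i).comp measurable_snd

theorem measurable_comp_inl {ι κ : Type*} :
    Measurable fun (w : ι ⊕ κ → ℝ) (i : ι) => w (Sum.inl i) :=
  measurable_pi_lambda _ fun _ => measurable_pi_apply _

theorem measurable_comp_inr {ι κ : Type*} :
    Measurable fun (w : ι ⊕ κ → ℝ) (i : κ) => w (Sum.inr i) :=
  measurable_pi_lambda _ fun _ => measurable_pi_apply _

section Sum

variable {ι κ : Type*}

theorem HasUniformMarginals.map_inl {μ : Measure (ι ⊕ κ → ℝ)} (hμ : HasUniformMarginals μ) :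
    HasUniformMarginals (μ.map fun w i => w (Sum.inl i)) := by
  have := hμ.1
  refine ⟨Measure.isProbabilityMeasure_map measurable_comp_inl.aemeasurable, fun i => ?_⟩
  rw [Measure.map_map (measurable_pi_apply i) measurable_comp_inl]
  exact hμ.2 (Sum.inl i)

theorem HasUniformMarginals.map_inr {μ : Measure (ι ⊕ κ → ℝ)} (hμ : HasUniformMarginals μ) :
    HasUniformMarginals (μ.map fun w i => w (Sum.inr i)) := by
  have := hμ.1
  refine ⟨Measure.isProbabilityMeasure_map measurable_comp_inr.aemeasurable, fun i => ?_⟩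
  rw [Measure.map_map (measurable_pi_apply i) measurable_comp_inr]
  exact hμ.2 (Sum.inr i)

/-- The product of two distributions, as a distribution on `ℝ^(ι ⊕ κ)`. -/
def sumProd (μ : Measure (ι → ℝ)) (ν : Measure (κ → ℝ)) : Measure (ι ⊕ κ → ℝ) :=
  (μ.prod ν).map fun p => Sum.elim p.1 p.2

theorem HasUniformMarginals.sumProd {μ : Measure (ι → ℝ)} {ν : Measure (κ → ℝ)}
    (hμ : HasUniformMarginals μ) (hν : HasUniformMarginals ν) :
    HasUniformMarginals (sumProd μ ν) := by
  have := hμ.1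
  have := hν.1
  refine ⟨Measure.isProbabilityMeasure_map measurable_sumElim.aemeasurable, fun i => ?_⟩
  rw [_root_.sumProd, Measure.map_map (measurable_pi_apply i) measurable_sumElim]
  rcases i with i | i
  · rw [← hμ.2 i, show (fun w : ι ⊕ κ → ℝ => w (Sum.inl i)) ∘ (fun p : (ι → ℝ) × (κ → ℝ) =>
      Sum.elim p.1 p.2) = (fun w : ι → ℝ => w i) ∘ Prod.fst from rfl,
      ← Measure.map_map (measurable_pi_apply i) measurable_fst, measurePreserving_fst.map_eq]
  · rw [← hν.2 i, show (fun w : ι ⊕ κ → ℝ => w (Sum.inr i)) ∘ (fun p : (ι → ℝ) × (κ → ℝ) =>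
      Sum.elim p.1 p.2) = (fun w : κ → ℝ => w i) ∘ Prod.snd from rfl,
      ← Measure.map_map (measurable_pi_apply i) measurable_snd, measurePreserving_snd.map_eq]

variable [Finite ι] [Finite κ]

/-- Coordinates bounded by `1` are unconstrained, as the distribution is carried by the unit cube.
-/
theorem marginLeft_cubeCdf {μ : Measure (ι ⊕ κ → ℝ)} (hμ : HasUniformMarginals μ) :
    marginLeft (cubeCdf μ) = cubeCdf (μ.map fun w i => w (Sum.inl i)) := by
  funext u
  simp only [marginLeft, cubeCdf, jointCdf]
  rw [measureReal_def, measureReal_def,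
    Measure.map_apply measurable_comp_inl (measurableSet_orthant _)]
  congr 1
  refine measure_congr ?_
  filter_upwards [hμ.ae_mem] with w hw
  refine propext ⟨fun h i => h (Sum.inl i), fun h i => ?_⟩
  rcases i with i | i
  · exact h i
  · exact (hw (Sum.inr i)).2

theorem marginRight_cubeCdf {μ : Measure (ι ⊕ κ → ℝ)} (hμ : HasUniformMarginals μ) :
    marginRight (cubeCdf μ) = cubeCdf (μ.map fun w i => w (Sum.inr i)) := by
  funext u
  simp only [marginRight, cubeCdf, jointCdf]
  rw [measureReal_def, measureReal_def,
    Measure.map_apply measurable_comp_inr (measurableSet_orthant _)]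
  congr 1
  refine measure_congr ?_
  filter_upwards [hμ.ae_mem] with w hw
  refine propext ⟨fun h i => h (Sum.inr i), fun h i => ?_⟩
  rcases i with i | i
  · exact (hw (Sum.inl i)).2
  · exact h i

theorem copulaTensor_cubeCdf (μ : Measure (ι → ℝ)) (ν : Measure (κ → ℝ)) [SFinite μ] [SFinite ν] :
    copulaTensor (cubeCdf μ) (cubeCdf ν) = cubeCdf (sumProd μ ν) := by
  funext u
  simp only [copulaTensor, cubeCdf, jointCdf, sumProd]
  rw [measureReal_def, measureReal_def, measureReal_def,
    Measure.map_apply measurable_sumElim (measurableSet_orthant _), ← ENNReal.toReal_mul,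
    ← Measure.prod_prod]
  congr 2
  ext p
  simp

/-- The Csiszár index is at most the divergence between the product of the marginals of a copula
for `(X, Y)` and the copula. -/
theorem csiszarIndex_le_copulaDivergence {Ω : Type*} [MeasurableSpace Ω] {P : Measure Ω}
    [IsProbabilityMeasure P] {X : Ω → ι → ℝ} {Y : Ω → κ → ℝ} (hX : Measurable X)
    (hY : Measurable Y) {f : ℝ → EReal} (hf : IsDivergenceFunction f) {C : (ι ⊕ κ → I) → ℝ}
    (hC : IsCopulaFor P (joinVec X Y) C) :
    csiszarIndex P f X Y ≤ copulaDivergence f (copulaTensor (marginLeft C) (marginRight C)) C := by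
  obtain ⟨μ, hμ, rfl⟩ := hC.1
  have hμl := hμ.map_inl
  have hμr := hμ.map_inr
  have := hμ.1
  have := hμl.1
  have := hμr.1
  have := (hμl.sumProd hμr).1
  have hZ : Measurable (joinVec X Y) := measurable_sumElim.comp (hX.prodMk hY)
  rw [marginLeft_cubeCdf hμ, marginRight_cubeCdf hμ, copulaTensor_cubeCdf, copulaDivergence,
    copulaMeasure_cubeCdf hμ, copulaMeasure_cubeCdf (hμl.sumProd hμr)]
  set q : (ι ⊕ κ → ℝ) → ι ⊕ κ → ℝ :=
    fun w i => quantile (P.map fun ω => joinVec X Y ω i) (w i) with hq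
  have hqm : Measurable q :=
    measurable_pi_lambda _ fun i => (measurable_quantile _).comp (measurable_pi_apply i)
  have hqμ : μ.map q = P.map (joinVec X Y) := hC.map_quantile hZ hμ
  set r : (ι ⊕ κ → ℝ) → (ι → ℝ) × (κ → ℝ) := fun w => (fun i => w (Sum.inl i), fun i => w (Sum.inr i))
    with hr
  have hrm : Measurable r := measurable_comp_inl.prodMk measurable_comp_inr
  set ql : (ι → ℝ) → ι → ℝ := fun w i => quantile (P.map fun ω => X ω i) (w i) with hql
  set qr : (κ → ℝ) → κ → ℝ := fun w i => quantile (P.map fun ω => Y ω i) (w i) with hqr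
  have hqlm : Measurable ql :=
    measurable_pi_lambda _ fun i => (measurable_quantile _).comp (measurable_pi_apply i)
  have hqrm : Measurable qr :=
    measurable_pi_lambda _ fun i => (measurable_quantile _).comp (measurable_pi_apply i)
  have e1 : P.map (fun ω => (X ω, Y ω)) = μ.map (r ∘ q) := by
    rw [← Measure.map_map hrm hqm, hqμ, Measure.map_map hrm hZ]
    rfl
  have e2 : P.map X = (μ.map fun w i => w (Sum.inl i)).map ql := by
    rw [Measure.map_map hqlm measurable_comp_inl,
      show ql ∘ (fun (w : ι ⊕ κ → ℝ) i => w (Sum.inl i)) = (fun w i => w (Sum.inl i)) ∘ q from rfl,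
      ← Measure.map_map measurable_comp_inl hqm, hqμ, Measure.map_map measurable_comp_inl hZ]
    rfl
  have e3 : P.map Y = (μ.map fun w i => w (Sum.inr i)).map qr := by
    rw [Measure.map_map hqrm measurable_comp_inr,
      show qr ∘ (fun (w : ι ⊕ κ → ℝ) i => w (Sum.inr i)) = (fun w i => w (Sum.inr i)) ∘ q from rfl,
      ← Measure.map_map measurable_comp_inr hqm, hqμ, Measure.map_map measurable_comp_inr hZ]
    rfl
  -- The quantile map acts coordinate by coordinate, so the map that produces the joint law also
  -- sends the product law to a product.
  have e4 : (P.map X).prod (P.map Y) = (sumProd (μ.map fun w i => w (Sum.inl i))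
      (μ.map fun w i => w (Sum.inr i))).map (r ∘ q) := by
    rw [e2, e3, Measure.map_prod_map _ _ hqlm hqrm, sumProd,
      Measure.map_map (hrm.comp hqm) measurable_sumElim]
    rfl
  rw [csiszarIndex, e1, e4]
  exact hf.fDivergence_map_le _ _ (hrm.comp hqm)

end Sum

/-! ### The randomized transform -/

theorem leftLim_cdf (ρ : Measure ℝ) [IsProbabilityMeasure ρ] (x : ℝ) :
    Function.leftLim (cdf ρ) x = ρ.real (Iio x) := by
  have h := (cdf ρ).measure_Iio (tendsto_cdf_atBot ρ) x
  rw [measure_cdf, sub_zero] at h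
  rw [measureReal_def, h, ENNReal.toReal_ofReal]
  exact (cdf_nonneg ρ (x - 1)).trans ((monotone_cdf ρ).le_leftLim (by linarith))

theorem cdf_eq_Iio_add_singleton (ρ : Measure ℝ) [IsProbabilityMeasure ρ] (x : ℝ) :
    cdf ρ x = ρ.real (Iio x) + ρ.real {x} := by
  rw [cdf_eq_real, ← measureReal_union (by simp) (measurableSet_singleton x)]
  congr 1
  ext y
  simp [le_iff_lt_or_eq]

section Randomized

variable {Ω ι : Type*} [MeasurableSpace Ω] {P : Measure Ω} {Z : Ω → ι → ℝ}

theorem measurable_noise_apply (i : ι) (x : atoms P fun ω => Z ω i) :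
    Measurable fun t : ∀ i, atoms P (fun ω => Z ω i) → ℝ => t i x :=
  (measurable_pi_apply x).comp (measurable_pi_apply i)

theorem countable_atoms [SFinite P] {ξ : Ω → ℝ} (hξ : Measurable ξ) : (atoms P ξ).Countable :=
  Measure.countable_meas_level_set_pos hξ

theorem randomizedTransform_of_mem (z : ι → ℝ) (t : ∀ i, atoms P (fun ω => Z ω i) → ℝ) (i : ι)
    (h : z i ∈ atoms P fun ω => Z ω i) :
    randomizedTransform P Z z t i = Function.leftLim (cdf (P.map fun ω => Z ω i)) (z i)
      + P.real {ω | Z ω i = z i} * t i ⟨z i, h⟩ := by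
  rw [randomizedTransform, tsum_eq_single ⟨z i, h⟩]
  · simp
  · intro x hx
    rw [indicator_of_notMem, mul_zero]
    intro hzx
    exact hx (Subtype.ext (mem_singleton_iff.1 hzx).symm)

theorem randomizedTransform_of_notMem (z : ι → ℝ) (t : ∀ i, atoms P (fun ω => Z ω i) → ℝ) (i : ι)
    (h : z i ∉ atoms P fun ω => Z ω i) :
    randomizedTransform P Z z t i = Function.leftLim (cdf (P.map fun ω => Z ω i)) (z i) := by
  rw [randomizedTransform]
  convert add_zero _
  convert tsum_zero with x
  rw [indicator_of_notMem, mul_zero]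
  intro hx
  exact h (by rw [mem_singleton_iff.1 hx]; exact x.2)

theorem measurable_randomizedTransform [SFinite P] (hZ : Measurable Z) :
    Measurable fun p : (ι → ℝ) × (∀ i, atoms P (fun ω => Z ω i) → ℝ) =>
      randomizedTransform P Z p.1 p.2 := by
  refine measurable_pi_lambda _ fun i => ?_
  have := (countable_atoms (P := P) (hZ.eval (a := i))).to_subtype
  have hz : Measurable fun p : (ι → ℝ) × (∀ i, atoms P (fun ω => Z ω i) → ℝ) => p.1 i :=
    (measurable_pi_apply i).comp measurable_fst
  refine Measurable.add ?_ (Measurable.tsum fun x => ?_)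
  · exact (monotone_cdf _).leftLim.measurable.comp hz
  · have ht : Measurable fun p : (ι → ℝ) × (∀ i, atoms P (fun ω => Z ω i) → ℝ) => p.2 i x :=
      (measurable_noise_apply i x).comp measurable_snd
    exact (ht.const_mul _).mul ((measurable_const.indicator (measurableSet_singleton _)).comp hz)

variable [IsProbabilityMeasure P]

/-- The noise moves the value only within the jump of the cdf at `z i`. The almost sure comparisons
of `U` with cdf levels rest on this. -/
theorem randomizedTransform_mem_Icc (hZ : Measurable Z) (z : ι → ℝ)
    (t : ∀ i, atoms P (fun ω => Z ω i) → ℝ) (i : ι) (ht : ∀ x, t i x ∈ Icc (0 : ℝ) 1) :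
    randomizedTransform P Z z t i ∈ Icc ((P.map fun ω => Z ω i).real (Iio (z i)))
      (cdf (P.map fun ω => Z ω i) (z i)) := by
  have hZi : Measurable fun ω => Z ω i := hZ.eval
  have := Measure.isProbabilityMeasure_map (μ := P) hZi.aemeasurable
  rw [cdf_eq_Iio_add_singleton]
  have hp : 0 ≤ (P.map fun ω => Z ω i).real {z i} := measureReal_nonneg
  by_cases h : z i ∈ atoms P fun ω => Z ω i
  · have hs : P.real {ω | Z ω i = z i} = (P.map fun ω => Z ω i).real {z i} := by
      rw [map_measureReal_apply hZi (measurableSet_singleton _)]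
      rfl
    rw [randomizedTransform_of_mem z t i h, leftLim_cdf, hs]
    have := ht ⟨z i, h⟩
    constructor <;> nlinarith [this.1, this.2]
  · rw [randomizedTransform_of_notMem z t i h, leftLim_cdf]
    exact ⟨le_rfl, le_add_of_nonneg_right hp⟩

theorem ae_mem_Icc_of_map_eq {ν : Measure (∀ i, atoms P (fun ω => Z ω i) → ℝ)}
    (hZ : Measurable Z) (i : ι) (hν : ∀ x, ν.map (fun t => t i x) = uniformUnit) :
    ∀ᵐ t ∂ν, ∀ x, t i x ∈ Icc (0 : ℝ) 1 := by
  have := (countable_atoms (P := P) (hZ.eval (a := i))).to_subtype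
  rw [ae_all_iff]
  intro x
  have h1 := ae_uniformUnit_mem_Ioo
  rw [← hν x] at h1
  exact (ae_of_ae_map (measurable_noise_apply i x).aemeasurable h1).mono fun t ht => Ioo_subset_Icc_self ht

/-- Each coordinate of the randomized transform is uniform on `[0, 1]`. -/
theorem map_randomizedTransform_apply (hZ : Measurable Z)
    {ν : Measure (∀ i, atoms P (fun ω => Z ω i) → ℝ)} [IsProbabilityMeasure ν] (i : ι)
    (hν : ∀ x, ν.map (fun t => t i x) = uniformUnit) :
    (P.prod ν).map (fun p => randomizedTransform P Z (Z p.1) p.2 i) = uniformUnit := by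
  have hZi : Measurable fun ω => Z ω i := hZ.eval
  set ρ := P.map fun ω => Z ω i with hρ
  have hρprob : IsProbabilityMeasure ρ := Measure.isProbabilityMeasure_map hZi.aemeasurable
  set U : Ω × (∀ i, atoms P (fun ω => Z ω i) → ℝ) → ℝ :=
    fun p => randomizedTransform P Z (Z p.1) p.2 i with hU
  have hUm : Measurable U := (measurable_pi_apply i).comp
    ((measurable_randomizedTransform (P := P) hZ).comp
      ((hZ.comp measurable_fst).prodMk measurable_snd))
  have hprob : IsProbabilityMeasure ((P.prod ν).map U) :=
    Measure.isProbabilityMeasure_map hUm.aemeasurable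
  have hae : ∀ᵐ p ∂(P.prod ν), ∀ x, p.2 i x ∈ Icc (0 : ℝ) 1 :=
    Measure.quasiMeasurePreserving_snd.ae (ae_mem_Icc_of_map_eq hZ i hν)
  have hb : ∀ᵐ p ∂(P.prod ν), U p ∈ Icc (ρ.real (Iio (Z p.1 i))) (cdf ρ (Z p.1 i)) :=
    hae.mono fun p hp => randomizedTransform_mem_Icc hZ _ _ _ hp
  refine eq_uniformUnit fun u hu => ?_
  -- The point where the cdf crosses level `u`: `F(z-) ≤ u ≤ F(z)`.
  set z := quantile ρ u with hz
  have hle : u ≤ cdf ρ z := (quantile_le_iff ρ hu).1 le_rfl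
  have hge : ρ.real (Iio z) ≤ u := by
    rw [← leftLim_cdf]
    refine le_of_tendsto ((monotone_cdf ρ).tendsto_leftLim z) ?_
    filter_upwards [self_mem_nhdsWithin] with y hy
    by_contra h
    exact absurd ((quantile_le_iff ρ hu).2 (not_le.1 h).le) (not_le.2 hy)
  have hmono : ∀ {x y : ℝ}, x < y → cdf ρ x ≤ ρ.real (Iio y) := fun {x y} hxy => by
    rw [cdf_eq_real]
    exact measureReal_mono (Iic_subset_Iio.2 hxy)
  rw [cdf_eq_Iio_add_singleton] at hle
  have hPlt : (P.prod ν) {p | Z p.1 i < z} = ENNReal.ofReal (ρ.real (Iio z)) := by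
    have : {p : Ω × (∀ i, atoms P (fun ω => Z ω i) → ℝ) | Z p.1 i < z}
        = ((fun ω => Z ω i) ⁻¹' Iio z) ×ˢ univ := by
      ext
      simp
    rw [this, Measure.prod_prod, measure_univ, mul_one, ofReal_measureReal,
      Measure.map_apply hZi measurableSet_Iio]
  -- `E` is `{Z_i < z}`, enlarged, when `z` is an atom, by the part of `{Z_i = z}` on which the
  -- noise stays low enough.
  obtain ⟨E, hE, hlt, hgt⟩ : ∃ E : Set (Ω × (∀ i, atoms P (fun ω => Z ω i) → ℝ)),
      (P.prod ν) E = ENNReal.ofReal u ∧ (∀ᵐ p ∂(P.prod ν), U p < u → p ∈ E) ∧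
        ∀ᵐ p ∂(P.prod ν), p ∈ E → U p ≤ u := by
    have hpz : P.real {ω | Z ω i = z} = ρ.real {z} := by
      rw [map_measureReal_apply hZi (measurableSet_singleton _)]
      rfl
    by_cases h0 : ρ.real {z} = 0
    · refine ⟨{p | Z p.1 i < z}, ?_, ?_, ?_⟩
      · rw [hPlt]
        congr 1
        linarith
      · have hne : ∀ᵐ p ∂(P.prod ν), Z p.1 i ≠ z := by
          refine Measure.quasiMeasurePreserving_fst.ae (p := fun ω => Z ω i ≠ z) ?_
          rw [ae_iff]
          simpa using (measureReal_eq_zero_iff (measure_ne_top P _)).1 (hpz.trans h0)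
        filter_upwards [hb, hne] with p hp hp' hpu
        refine lt_of_le_of_ne (not_lt.1 fun h => ?_) hp'
        have := (hmono h).trans hp.1
        rw [cdf_eq_Iio_add_singleton] at this
        linarith
      · filter_upwards [hb] with p hp hpz
        exact hp.2.trans ((hmono hpz).trans hge)
    · have hpos : 0 < ρ.real {z} := lt_of_le_of_ne measureReal_nonneg (Ne.symm h0)
      have hmem : z ∈ atoms P fun ω => Z ω i := by
        rw [← hpz] at hpos
        exact (ENNReal.toReal_pos_iff.1 hpos).1
      -- The fraction of the jump at `z` needed to climb from `F(z-)` to `u`.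
      set s := (u - ρ.real (Iio z)) / ρ.real {z} with hs
      have hsp : ρ.real {z} * s = u - ρ.real (Iio z) := mul_div_cancel₀ _ h0
      have hs1 : s ≤ 1 := by
        rw [hs, div_le_one hpos]
        linarith
      have hUz : ∀ p : Ω × (∀ i, atoms P (fun ω => Z ω i) → ℝ), Z p.1 i = z →
          U p = ρ.real (Iio z) + ρ.real {z} * p.2 i ⟨z, hmem⟩ := by
        intro p hp
        have hp' : Z p.1 i ∈ atoms P fun ω => Z ω i := hp ▸ hmem
        simp only [hU]
        rw [randomizedTransform_of_mem _ _ _ hp', leftLim_cdf]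
        simp only [hp]
        rw [hpz]
      refine ⟨{p | Z p.1 i < z} ∪ {ω | Z ω i = z} ×ˢ {t | t i ⟨z, hmem⟩ ≤ s}, ?_, ?_, ?_⟩
      · have hTm := measurable_noise_apply (P := P) (Z := Z) i ⟨z, hmem⟩
        rw [measure_union, hPlt, Measure.prod_prod]
        · have h1 : ν {t | t i ⟨z, hmem⟩ ≤ s} = ENNReal.ofReal s := by
            rw [← uniformUnit_Iic hs1, ← hν ⟨z, hmem⟩, Measure.map_apply hTm measurableSet_Iic]
            rfl
          rw [h1, ← ofReal_measureReal, hpz, ← ENNReal.ofReal_mul hpos.le,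
            ← ENNReal.ofReal_add measureReal_nonneg (by rw [hsp]; linarith), hsp]
          congr 1
          ring
        · refine Set.disjoint_left.2 fun p hp hp' => ?_
          exact (ne_of_lt hp) hp'.1
        · exact (hZi (measurableSet_singleton z)).prod (hTm measurableSet_Iic)
      · filter_upwards [hb] with p hp hpu
        rcases lt_trichotomy (Z p.1 i) z with h | h | h
        · exact .inl h
        · refine .inr ⟨h, ?_⟩
          rw [hUz p h] at hpu
          have : ρ.real {z} * p.2 i ⟨z, hmem⟩ ≤ ρ.real {z} * s := by linarith
          exact le_of_mul_le_mul_left this hpos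
        · have := (hmono h).trans hp.1
          rw [cdf_eq_Iio_add_singleton] at this
          linarith
      · filter_upwards [hb] with p hp hpE
        rcases hpE with h | ⟨h, h'⟩
        · exact hp.2.trans ((hmono h).trans hge)
        · rw [hUz p h]
          have : ρ.real {z} * p.2 i ⟨z, hmem⟩ ≤ ρ.real {z} * s :=
            mul_le_mul_of_nonneg_left h' hpos.le
          linarith
  rw [Measure.map_apply hUm measurableSet_Iio, Measure.map_apply hUm measurableSet_Iic, ← hE]
  exact ⟨measure_mono_ae hlt, measure_mono_ae hgt⟩

/-- The law of the randomized transform of `Z` with the randomization `ν`. -/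
def randomizedLaw (P : Measure Ω) (Z : Ω → ι → ℝ)
    (ν : Measure (∀ i, atoms P (fun ω => Z ω i) → ℝ)) : Measure (ι → ℝ) :=
  (P.prod ν).map fun p => randomizedTransform P Z (Z p.1) p.2

theorem measurable_randomizedTransform_comp (hZ : Measurable Z) :
    Measurable fun p : Ω × (∀ i, atoms P (fun ω => Z ω i) → ℝ) =>
      randomizedTransform P Z (Z p.1) p.2 :=
  (measurable_randomizedTransform (P := P) hZ).comp ((hZ.comp measurable_fst).prodMk measurable_snd)

variable {ν : Measure (∀ i, atoms P (fun ω => Z ω i) → ℝ)} [IsProbabilityMeasure ν]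

theorem hasUniformMarginals_randomizedLaw (hZ : Measurable Z)
    (hν : ∀ i x, ν.map (fun t => t i x) = uniformUnit) :
    HasUniformMarginals (randomizedLaw P Z ν) := by
  have hm := measurable_randomizedTransform_comp (P := P) hZ
  refine ⟨Measure.isProbabilityMeasure_map hm.aemeasurable, fun i => ?_⟩
  rw [randomizedLaw, Measure.map_map (measurable_pi_apply i) hm]
  exact map_randomizedTransform_apply hZ i (hν i)

/-- For each `i`, `{Z_i ≤ z_i}` is almost surely contained in `{U_i ≤ F_i(z_i)}`, and both have
probability `F_i(z_i)` because `U_i` is uniform. The events thus agree almost surely, and so do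
their intersections, whatever the dependence within the noise. -/
theorem isCopulaFor_randomizedCdf [Finite ι] (hZ : Measurable Z)
    (hν : ∀ i x, ν.map (fun t => t i x) = uniformUnit) :
    IsCopulaFor P Z (randomizedCdf P Z ν) := by
  have hm := measurable_randomizedTransform_comp (P := P) hZ
  refine ⟨⟨_, hasUniformMarginals_randomizedLaw hZ hν, rfl⟩, fun z => ?_⟩
  simp only [randomizedCdf, cubeCdf, jointCdf]
  rw [map_measureReal_apply hZ (measurableSet_orthant _),
    map_measureReal_apply hm (measurableSet_orthant _), measureReal_def, measureReal_def,
    ← (measurePreserving_fst (μ := P) (ν := ν)).measure_preimage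
      (hZ (measurableSet_orthant z)).nullMeasurableSet]
  congr 1
  have key : ∀ i, {p : Ω × (∀ i, atoms P (fun ω => Z ω i) → ℝ) | Z p.1 i ≤ z i} =ᵐ[P.prod ν]
      {p | randomizedTransform P Z (Z p.1) p.2 i ≤ cdf (P.map fun ω => Z ω i) (z i)} := by
    intro i
    have hZi : Measurable fun ω => Z ω i := hZ.eval
    have := Measure.isProbabilityMeasure_map (μ := P) hZi.aemeasurable
    have hA : MeasurableSet {ω | Z ω i ≤ z i} := hZi measurableSet_Iic
    refine ae_eq_of_ae_subset_of_measure_ge ?_ ?_ (measurable_fst hA).nullMeasurableSet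
      (measure_ne_top _ _)
    · have hae : ∀ᵐ p ∂(P.prod ν), ∀ x, p.2 i x ∈ Icc (0 : ℝ) 1 :=
        Measure.quasiMeasurePreserving_snd.ae (ae_mem_Icc_of_map_eq hZ i (hν i))
      filter_upwards [hae] with p hp hpz
      exact (randomizedTransform_mem_Icc hZ _ _ _ hp).2.trans (monotone_cdf _ hpz)
    · refine le_of_eq ?_
      have h1 : (P.prod ν) {p | Z p.1 i ≤ z i} = P {ω | Z ω i ≤ z i} :=
        (measurePreserving_fst (μ := P) (ν := ν)).measure_preimage hA.nullMeasurableSet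
      have h2 := map_randomizedTransform_apply (ν := ν) hZ i (hν i)
      have h3 := congrArg (fun M => M (Iic (cdf (P.map fun ω => Z ω i) (z i)))) h2
      have hmi : Measurable fun p : Ω × (∀ i, atoms P (fun ω => Z ω i) → ℝ) =>
          randomizedTransform P Z (Z p.1) p.2 i := (measurable_pi_apply i).comp hm
      rw [Measure.map_apply hmi measurableSet_Iic,
        uniformUnit_Iic (cdf_le_one _ _), ofReal_cdf, Measure.map_apply hZi measurableSet_Iic] at h3
      exact h3.trans h1.symm
  have hall : ∀ᵐ p ∂(P.prod ν), ∀ i, (Z p.1 i ≤ z i ↔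
      randomizedTransform P Z (Z p.1) p.2 i ≤ cdf (P.map fun ω => Z ω i) (z i)) :=
    ae_all_iff.2 fun i => (key i).mem_iff
  exact measure_congr (hall.mono fun p hp => propext (forall_congr' hp))

end Randomized

/-! ### Independent randomizations of two vectors -/

theorem map_prodProdProdComm {α β γ δ : Type*} [MeasurableSpace α] [MeasurableSpace β]
    [MeasurableSpace γ] [MeasurableSpace δ] (μ₁ : Measure α) (μ₂ : Measure β) (ν₁ : Measure γ)
    (ν₂ : Measure δ) [SFinite μ₁] [SFinite μ₂] [SFinite ν₁] [SFinite ν₂] :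
    ((μ₁.prod μ₂).prod (ν₁.prod ν₂)).map (Equiv.prodProdProdComm α β γ δ) =
      (μ₁.prod ν₁).prod (μ₂.prod ν₂) := by
  have hm : Measurable (Equiv.prodProdProdComm α β γ δ) :=
    ((measurable_fst.comp measurable_fst).prodMk (measurable_fst.comp measurable_snd)).prodMk
      ((measurable_snd.comp measurable_fst).prodMk (measurable_snd.comp measurable_snd))
  refine Measure.ext_of_lintegral _ fun g hg => ?_
  have hg' : Measurable fun p => g (Equiv.prodProdProdComm α β γ δ p) := hg.comp hm
  rw [lintegral_map hg hm, lintegral_prod _ hg'.aemeasurable,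
    lintegral_prod _ (hg'.lintegral_prod_right').aemeasurable, lintegral_prod _ hg.aemeasurable,
    lintegral_prod _ (hg.lintegral_prod_right').aemeasurable]
  refine lintegral_congr fun x => ?_
  have h1 : ∀ y, ∫⁻ p, g (Equiv.prodProdProdComm α β γ δ ((x, y), p)) ∂(ν₁.prod ν₂) =
      ∫⁻ t, ∫⁻ w, g ((x, t), (y, w)) ∂ν₂ ∂ν₁ := fun y =>
    lintegral_prod (fun p => g (Equiv.prodProdProdComm α β γ δ ((x, y), p)))
      (hg'.comp measurable_prodMk_left).aemeasurable
  have h2 : ∀ t, ∫⁻ p, g ((x, t), p) ∂(μ₂.prod ν₂) = ∫⁻ y, ∫⁻ w, g ((x, t), (y, w)) ∂ν₂ ∂μ₂ :=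
    fun t => lintegral_prod (fun p => g ((x, t), p)) (hg.comp measurable_prodMk_left).aemeasurable
  simp_rw [h1, h2]
  refine lintegral_lintegral_swap (Measurable.aemeasurable ?_)
  have h3 : Measurable fun p : (β × γ) × δ => g ((x, p.1.2), (p.1.1, p.2)) := by fun_prop
  exact h3.lintegral_prod_right'

section Join

variable {Ω ι κ : Type*} [MeasurableSpace Ω] {P : Measure Ω} {X : Ω → ι → ℝ} {Y : Ω → κ → ℝ}

theorem measurable_joinVec (hX : Measurable X) (hY : Measurable Y) : Measurable (joinVec X Y) :=
  measurable_sumElim.comp (hX.prodMk hY)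

/-- A randomization of `(X, Y)` from randomizations of `X` and of `Y`. -/
def joinNoise (P : Measure Ω) (X : Ω → ι → ℝ) (Y : Ω → κ → ℝ)
    (p : (∀ i, atoms P (fun ω => X ω i) → ℝ) × (∀ j, atoms P (fun ω => Y ω j) → ℝ)) :
    ∀ i, atoms P (fun ω => joinVec X Y ω i) → ℝ
  | Sum.inl i => p.1 i
  | Sum.inr j => p.2 j

theorem measurable_joinNoise : Measurable (joinNoise P X Y) := by
  refine measurable_pi_lambda _ fun i => ?_
  rcases i with i | j
  · exact (measurable_pi_apply i).comp measurable_fst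
  · exact (measurable_pi_apply j).comp measurable_snd

/-- Coordinates of `joinVec X Y` reduce to those of `X` or `Y`, so the atom sets, and hence the
noise types, agree definitionally. -/
theorem randomizedTransform_joinVec (x : ι → ℝ) (y : κ → ℝ)
    (p : (∀ i, atoms P (fun ω => X ω i) → ℝ) × (∀ j, atoms P (fun ω => Y ω j) → ℝ)) :
    randomizedTransform P (joinVec X Y) (Sum.elim x y) (joinNoise P X Y p) =
      Sum.elim (randomizedTransform P X x p.1) (randomizedTransform P Y y p.2) := by
  funext i
  rcases i with i | j <;> rfl

/-- The randomized transforms of `X` and of `Y`, as a function of the values and the noise. -/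
def randomizedPair (P : Measure Ω) (X : Ω → ι → ℝ) (Y : Ω → κ → ℝ)
    (p : ((ι → ℝ) × (κ → ℝ)) ×
      ((∀ i, atoms P (fun ω => X ω i) → ℝ) × (∀ j, atoms P (fun ω => Y ω j) → ℝ))) : ι ⊕ κ → ℝ :=
  Sum.elim (randomizedTransform P X p.1.1 p.2.1) (randomizedTransform P Y p.1.2 p.2.2)

theorem measurable_randomizedPair [SFinite P] (hX : Measurable X) (hY : Measurable Y) :
    Measurable (randomizedPair P X Y) := by
  refine measurable_sumElim.comp (Measurable.prodMk ?_ ?_)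
  · exact (measurable_randomizedTransform hX).comp
      ((measurable_fst.comp measurable_fst).prodMk (measurable_fst.comp measurable_snd))
  · exact (measurable_randomizedTransform hY).comp
      ((measurable_snd.comp measurable_fst).prodMk (measurable_snd.comp measurable_snd))

variable {νT : Measure (∀ i, atoms P (fun ω => X ω i) → ℝ)}
  {νW : Measure (∀ j, atoms P (fun ω => Y ω j) → ℝ)} [IsProbabilityMeasure νT]
  [IsProbabilityMeasure νW]

theorem map_joinNoise_apply (hT : ∀ i x, νT.map (fun t => t i x) = uniformUnit)
    (hW : ∀ j y, νW.map (fun t => t j y) = uniformUnit) (i : ι ⊕ κ)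
    (x : atoms P (fun ω => joinVec X Y ω i)) :
    ((νT.prod νW).map (joinNoise P X Y)).map (fun t => t i x) = uniformUnit := by
  rw [Measure.map_map (measurable_noise_apply i x) measurable_joinNoise]
  rcases i with i | j
  · rw [← hT i x, ← (measurePreserving_fst (μ := νT) (ν := νW)).map_eq,
      Measure.map_map (measurable_noise_apply i x) measurable_fst, (measurePreserving_fst (μ := νT) (ν := νW)).map_eq]
    rfl
  · rw [← hW j x, ← (measurePreserving_snd (μ := νT) (ν := νW)).map_eq,
      Measure.map_map (measurable_noise_apply j x) measurable_snd, (measurePreserving_snd (μ := νT) (ν := νW)).map_eq]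
    rfl

variable [IsProbabilityMeasure P]

theorem randomizedLaw_joinVec (hX : Measurable X) (hY : Measurable Y) :
    randomizedLaw P (joinVec X Y) ((νT.prod νW).map (joinNoise P X Y)) =
      ((P.map fun ω => (X ω, Y ω)).prod (νT.prod νW)).map (randomizedPair P X Y) := by
  have h1 : P.prod ((νT.prod νW).map (joinNoise P X Y)) =
      (P.prod (νT.prod νW)).map (Prod.map id (joinNoise P X Y)) := by
    rw [← Measure.map_prod_map _ _ measurable_id measurable_joinNoise, Measure.map_id]
  have h2 : (P.map fun ω => (X ω, Y ω)).prod (νT.prod νW) =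
      (P.prod (νT.prod νW)).map (Prod.map (fun ω => (X ω, Y ω)) id) := by
    rw [← Measure.map_prod_map _ _ (hX.prodMk hY) measurable_id, Measure.map_id]
  rw [randomizedLaw, h1, h2, Measure.map_map
    (measurable_randomizedTransform_comp (measurable_joinVec hX hY))
    (measurable_id.prodMap measurable_joinNoise),
    Measure.map_map (measurable_randomizedPair hX hY) ((hX.prodMk hY).prodMap measurable_id)]
  congr 1
  funext p
  exact randomizedTransform_joinVec _ _ _

/-- The noise of the pair is itself a product, so values and noises can be regrouped. Together with
`randomizedLaw_joinVec`, this exhibits both copula laws as images under one map with one common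
noise. -/
theorem sumProd_randomizedLaw (hX : Measurable X) (hY : Measurable Y) :
    sumProd (randomizedLaw P X νT) (randomizedLaw P Y νW) =
      (((P.map X).prod (P.map Y)).prod (νT.prod νW)).map (randomizedPair P X Y) := by
  have hXm := measurable_randomizedTransform_comp (P := P) hX
  have hYm := measurable_randomizedTransform_comp (P := P) hY
  have h1 : ((P.map X).prod (P.map Y)).prod (νT.prod νW) =
      ((P.prod P).prod (νT.prod νW)).map (Prod.map (Prod.map X Y) id) := by
    rw [← Measure.map_prod_map _ _ (hX.prodMap hY) measurable_id, Measure.map_id,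
      Measure.map_prod_map _ _ hX hY]
  have hc : Measurable (Equiv.prodProdProdComm Ω Ω (∀ i, atoms P (fun ω => X ω i) → ℝ)
      (∀ j, atoms P (fun ω => Y ω j) → ℝ)) :=
    ((measurable_fst.comp measurable_fst).prodMk (measurable_fst.comp measurable_snd)).prodMk
      ((measurable_snd.comp measurable_fst).prodMk (measurable_snd.comp measurable_snd))
  rw [sumProd, randomizedLaw, randomizedLaw, Measure.map_prod_map _ _ hXm hYm,
    ← map_prodProdProdComm, Measure.map_map (hXm.prodMap hYm) hc,
    Measure.map_map measurable_sumElim ((hXm.prodMap hYm).comp hc), h1,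
    Measure.map_map (measurable_randomizedPair hX hY) ((hX.prodMap hY).prodMap measurable_id)]
  rfl

theorem map_inl_randomizedLaw_joinVec (hX : Measurable X) (hY : Measurable Y) :
    (randomizedLaw P (joinVec X Y) ((νT.prod νW).map (joinNoise P X Y))).map
      (fun w i => w (Sum.inl i)) = randomizedLaw P X νT := by
  have hXm := measurable_randomizedTransform_comp (P := P) hX
  have h1 : P.prod νT = (P.prod (νT.prod νW)).map (Prod.map id Prod.fst) := by
    rw [← Measure.map_prod_map _ _ measurable_id measurable_fst, Measure.map_id,
      (measurePreserving_fst (μ := νT) (ν := νW)).map_eq]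
  have h2 : P.prod ((νT.prod νW).map (joinNoise P X Y)) =
      (P.prod (νT.prod νW)).map (Prod.map id (joinNoise P X Y)) := by
    rw [← Measure.map_prod_map _ _ measurable_id measurable_joinNoise, Measure.map_id]
  have hJ := measurable_randomizedTransform_comp (P := P) (measurable_joinVec hX hY)
  rw [randomizedLaw, randomizedLaw, h1, h2, Measure.map_map measurable_comp_inl hJ,
    Measure.map_map (measurable_comp_inl.comp hJ) (measurable_id.prodMap measurable_joinNoise),
    Measure.map_map hXm (measurable_id.prodMap measurable_fst)]
  rfl

theorem map_inr_randomizedLaw_joinVec (hX : Measurable X) (hY : Measurable Y) :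
    (randomizedLaw P (joinVec X Y) ((νT.prod νW).map (joinNoise P X Y))).map
      (fun w i => w (Sum.inr i)) = randomizedLaw P Y νW := by
  have hYm := measurable_randomizedTransform_comp (P := P) hY
  have h1 : P.prod νW = (P.prod (νT.prod νW)).map (Prod.map id Prod.snd) := by
    rw [← Measure.map_prod_map _ _ measurable_id measurable_snd, Measure.map_id,
      (measurePreserving_snd (μ := νT) (ν := νW)).map_eq]
  have h2 : P.prod ((νT.prod νW).map (joinNoise P X Y)) =
      (P.prod (νT.prod νW)).map (Prod.map id (joinNoise P X Y)) := by
    rw [← Measure.map_prod_map _ _ measurable_id measurable_joinNoise, Measure.map_id]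
  have hJ := measurable_randomizedTransform_comp (P := P) (measurable_joinVec hX hY)
  rw [randomizedLaw, randomizedLaw, h1, h2, Measure.map_map measurable_comp_inr hJ,
    Measure.map_map (measurable_comp_inr.comp hJ) (measurable_id.prodMap measurable_joinNoise),
    Measure.map_map hYm (measurable_id.prodMap measurable_snd)]
  rfl

/-- Equality in `csiszarIndex_le_copulaDivergence` for independent randomizations of `X` and
`Y`. -/
theorem randomizedCdf_joinVec [Finite ι] [Finite κ] (hX : Measurable X) (hY : Measurable Y)
    (hT : ∀ i x, νT.map (fun t => t i x) = uniformUnit)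
    (hW : ∀ j y, νW.map (fun t => t j y) = uniformUnit) {C : (ι ⊕ κ → I) → ℝ}
    (hC : C = randomizedCdf P (joinVec X Y) ((νT.prod νW).map (joinNoise P X Y))) :
    IsCopulaFor P (joinVec X Y) C ∧ marginLeft C = randomizedCdf P X νT ∧
      marginRight C = randomizedCdf P Y νW ∧
      ∀ f : ℝ → EReal, IsDivergenceFunction f → csiszarIndex P f X Y =
        copulaDivergence f (copulaTensor (marginLeft C) (marginRight C)) C := by
  subst hC
  have hZ := measurable_joinVec hX hY
  have hν := map_joinNoise_apply (P := P) (X := X) (Y := Y) hT hW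
  have : IsProbabilityMeasure ((νT.prod νW).map (joinNoise P X Y)) :=
    Measure.isProbabilityMeasure_map measurable_joinNoise.aemeasurable
  have hcop := isCopulaFor_randomizedCdf hZ hν
  have hunif := hasUniformMarginals_randomizedLaw hZ hν
  have hl : marginLeft (randomizedCdf P (joinVec X Y) ((νT.prod νW).map (joinNoise P X Y))) =
      cubeCdf (randomizedLaw P X νT) := by
    rw [← map_inl_randomizedLaw_joinVec (νW := νW) hX hY]
    exact marginLeft_cubeCdf hunif
  have hr : marginRight (randomizedCdf P (joinVec X Y) ((νT.prod νW).map (joinNoise P X Y))) =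
      cubeCdf (randomizedLaw P Y νW) := by
    rw [← map_inr_randomizedLaw_joinVec (νT := νT) hX hY]
    exact marginRight_cubeCdf hunif
  refine ⟨hcop, hl, hr, fun f hf => le_antisymm (csiszarIndex_le_copulaDivergence hX hY hf hcop) ?_⟩
  have hul := hasUniformMarginals_randomizedLaw (P := P) hX hT
  have hur := hasUniformMarginals_randomizedLaw (P := P) hY hW
  have := hul.1
  have := hur.1
  have := Measure.isProbabilityMeasure_map (μ := P) hX.aemeasurable
  have := Measure.isProbabilityMeasure_map (μ := P) hY.aemeasurable
  have := Measure.isProbabilityMeasure_map (μ := P) (hX.prodMk hY).aemeasurable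
  rw [hl, hr, copulaTensor_cubeCdf, copulaDivergence, copulaMeasure_cubeCdf (hul.sumProd hur),
    show randomizedCdf P (joinVec X Y) ((νT.prod νW).map (joinNoise P X Y)) =
      cubeCdf (randomizedLaw P (joinVec X Y) ((νT.prod νW).map (joinNoise P X Y))) from rfl,
    copulaMeasure_cubeCdf hunif, randomizedLaw_joinVec hX hY, sumProd_randomizedLaw hX hY,
    csiszarIndex]
  -- The converse inequality: the noise `νT.prod νW` is the independent input shared by both
  -- measures.
  exact hf.fDivergence_map_prod_le _ _ _ (measurable_randomizedPair hX hY)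

end Join

/-! ### Checkerboard copulas -/

section Checkerboard

variable {Ω ι κ : Type*} [MeasurableSpace Ω] {P : Measure Ω}

/-- The randomization with a single variable for all atoms of a coordinate. -/
def checkerboardNoise [Fintype ι] (P : Measure Ω) (Z : Ω → ι → ℝ) :
    Measure (∀ i, atoms P (fun ω => Z ω i) → ℝ) :=
  (Measure.pi fun _ : ι => uniformUnit).map fun s i (_ : atoms P (fun ω => Z ω i)) => s i

theorem measurable_constNoise {Z : Ω → ι → ℝ} :
    Measurable fun (s : ι → ℝ) i (_ : atoms P (fun ω => Z ω i)) => s i :=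
  measurable_pi_lambda _ fun i => measurable_pi_lambda _ fun _ => measurable_pi_apply i

instance [Fintype ι] (Z : Ω → ι → ℝ) : IsProbabilityMeasure (checkerboardNoise P Z) :=
  Measure.isProbabilityMeasure_map measurable_constNoise.aemeasurable

theorem map_checkerboardNoise_apply [Fintype ι] (Z : Ω → ι → ℝ) (i : ι)
    (x : atoms P (fun ω => Z ω i)) :
    (checkerboardNoise P Z).map (fun t => t i x) = uniformUnit := by
  rw [checkerboardNoise, Measure.map_map (measurable_noise_apply i x) measurable_constNoise]
  exact (measurePreserving_eval (fun _ : ι => uniformUnit) i).map_eq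

/-- A product of uniform laws over `ι ⊕ κ` splits into the two blocks, which makes the checkerboard
case an instance of independent randomizations. -/
theorem checkerboardNoise_joinVec [Fintype ι] [Fintype κ] (X : Ω → ι → ℝ) (Y : Ω → κ → ℝ) :
    checkerboardNoise P (joinVec X Y) =
      ((checkerboardNoise P X).prod (checkerboardNoise P Y)).map (joinNoise P X Y) := by
  have hs := (measurePreserving_sumPiEquivProdPi_symm (X := fun _ : ι ⊕ κ => ℝ)
    fun _ => uniformUnit).map_eq
  rw [checkerboardNoise, checkerboardNoise, checkerboardNoise, ← hs,
    Measure.map_prod_map _ _ measurable_constNoise measurable_constNoise,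
    Measure.map_map measurable_constNoise (MeasurableEquiv.measurable _),
    Measure.map_map measurable_joinNoise (measurable_constNoise.prodMap measurable_constNoise)]
  congr 1
  funext p i
  rcases i with i | j <;> rfl

end Checkerboard

/-! ### The main theorem -/

end

theorem mainTheorem2 {Ω : Type*} [MeasurableSpace Ω] (P : Measure Ω) [IsProbabilityMeasure P]
    {m n : ℕ} (X : Ω → Fin m → ℝ) (Y : Ω → Fin n → ℝ) (hX : Measurable X) (hY : Measurable Y)
    (f : ℝ → EReal) (hf : IsDivergenceFunction f) :
    -- every copula of `(X, Y)` has at least the divergence `S_f(X, Y)`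
    (∀ C : (Fin m ⊕ Fin n → I) → ℝ, IsCopulaFor P (joinVec X Y) C →
      csiszarIndex P f X Y ≤
        copulaDivergence f (copulaTensor (marginLeft C) (marginRight C)) C) ∧
    -- equality for the interpolating copulas with `T`, `W`, `(X, Y)` independent
    (∀ (T : ∀ i, atoms P (fun ω => X ω i) → Ω → ℝ) (W : ∀ j, atoms P (fun ω => Y ω j) → Ω → ℝ),
      (∀ i x, Measurable (T i x)) → (∀ j y, Measurable (W j y)) →
      (∀ i x, P.map (T i x) = uniformUnit) → (∀ j y, P.map (W j y) = uniformUnit) →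
      IndepFun (fun ω i x => T i x ω) (fun ω j y => W j y ω) P →
      IndepFun (fun ω => ((fun i x => T i x ω : ∀ i, atoms P (fun ω => X ω i) → ℝ),
          (fun j y => W j y ω : ∀ j, atoms P (fun ω => Y ω j) → ℝ)))
        (fun ω => (X ω, Y ω)) P →
      ∀ (U : Ω → Fin m → ℝ) (V : Ω → Fin n → ℝ) (C : (Fin m ⊕ Fin n → I) → ℝ),
      (∀ ω, U ω = randomizedTransform P X (X ω) fun i x => T i x ω) →
      (∀ ω, V ω = randomizedTransform P Y (Y ω) fun j y => W j y ω) →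
      C = cubeCdf (P.map (joinVec U V)) →
      IsCopulaFor P (joinVec X Y) C ∧
      IsInterpolatingCopula P (joinVec X Y) C ∧
      marginLeft C = cubeCdf (P.map U) ∧ IsInterpolatingCopula P X (marginLeft C) ∧
      marginRight C = cubeCdf (P.map V) ∧ IsInterpolatingCopula P Y (marginRight C) ∧
      csiszarIndex P f X Y =
        copulaDivergence f (copulaTensor (marginLeft C) (marginRight C)) C) ∧
    -- equality for the checkerboard copulas, and the minimum over all copulas of `(X, Y)`
    (IsCopulaFor P (joinVec X Y) (checkerboardCopula P (joinVec X Y)) ∧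
      marginLeft (checkerboardCopula P (joinVec X Y)) = checkerboardCopula P X ∧
      marginRight (checkerboardCopula P (joinVec X Y)) = checkerboardCopula P Y ∧
      csiszarIndex P f X Y =
        copulaDivergence f (copulaTensor (checkerboardCopula P X) (checkerboardCopula P Y))
          (checkerboardCopula P (joinVec X Y)) ∧
      IsLeast {d : EReal | ∃ C : (Fin m ⊕ Fin n → I) → ℝ, IsCopulaFor P (joinVec X Y) C ∧
          d = copulaDivergence f (copulaTensor (marginLeft C) (marginRight C)) C}
        (csiszarIndex P f X Y)) := by

  have part1 : ∀ C : (Fin m ⊕ Fin n → I) → ℝ, IsCopulaFor P (joinVec X Y) C →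
      csiszarIndex P f X Y ≤
        copulaDivergence f (copulaTensor (marginLeft C) (marginRight C)) C :=
    fun C hC => csiszarIndex_le_copulaDivergence hX hY hf hC
  refine ⟨part1, ?_, ?_⟩
  · intro T W hTm hWm hT hW hTW hind U V C hU hV hC
    have hTm' : Measurable fun ω => (fun i x => T i x ω : ∀ i, atoms P (fun ω => X ω i) → ℝ) :=
      measurable_pi_lambda _ fun i => measurable_pi_lambda _ fun x => hTm i x
    have hWm' : Measurable fun ω => (fun j y => W j y ω : ∀ j, atoms P (fun ω => Y ω j) → ℝ) :=
      measurable_pi_lambda _ fun j => measurable_pi_lambda _ fun y => hWm j y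
    set νT := P.map fun ω => (fun i x => T i x ω : ∀ i, atoms P (fun ω => X ω i) → ℝ) with hνT
    set νW := P.map fun ω => (fun j y => W j y ω : ∀ j, atoms P (fun ω => Y ω j) → ℝ) with hνW
    have := Measure.isProbabilityMeasure_map (μ := P) hTm'.aemeasurable
    have := Measure.isProbabilityMeasure_map (μ := P) hWm'.aemeasurable
    have hT' : ∀ i x, νT.map (fun t => t i x) = uniformUnit := fun i x => by
      rw [hνT, Measure.map_map (measurable_noise_apply i x) hTm']
      exact hT i x
    have hW' : ∀ j y, νW.map (fun t => t j y) = uniformUnit := fun j y => by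
      rw [hνW, Measure.map_map (measurable_noise_apply j y) hWm']
      exact hW j y
    -- The two independence hypotheses together factor the law of `((X, Y), (T, W))` as `P_(X,Y) ⊗
    -- (νT ⊗ νW)`.
    have hlaw := hind.symm.map_prod_eq_prod_map_map (hX.prodMk hY).aemeasurable
      (hTm'.prodMk hWm').aemeasurable
    rw [hTW.map_prod_eq_prod_map_map hTm'.aemeasurable hWm'.aemeasurable] at hlaw
    have hUm : Measurable U := by
      rw [funext hU]
      exact (measurable_randomizedTransform hX).comp (hX.prodMk hTm')
    have hVm : Measurable V := by
      rw [funext hV]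
      exact (measurable_randomizedTransform hY).comp (hY.prodMk hWm')
    have hUV : P.map (joinVec U V) =
        randomizedLaw P (joinVec X Y) ((νT.prod νW).map (joinNoise P X Y)) := by
      rw [randomizedLaw_joinVec hX hY, ← hlaw, Measure.map_map (measurable_randomizedPair hX hY)
        ((hX.prodMk hY).prodMk (hTm'.prodMk hWm'))]
      congr 1
      funext ω
      rw [joinVec, hU, hV]
      rfl
    have hC' : C = randomizedCdf P (joinVec X Y) ((νT.prod νW).map (joinNoise P X Y)) := by
      rw [hC, hUV]
      rfl
    obtain ⟨h1, h2, h3, h4⟩ := randomizedCdf_joinVec hX hY hT' hW' hC'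
    have hunif : HasUniformMarginals (P.map (joinVec U V)) := by
      have : IsProbabilityMeasure ((νT.prod νW).map (joinNoise P X Y)) :=
        Measure.isProbabilityMeasure_map measurable_joinNoise.aemeasurable
      rw [hUV]
      exact hasUniformMarginals_randomizedLaw (measurable_joinVec hX hY)
        (map_joinNoise_apply hT' hW')
    refine ⟨h1, ⟨_, Measure.isProbabilityMeasure_map measurable_joinNoise.aemeasurable,
      map_joinNoise_apply hT' hW', hC'⟩, ?_, ⟨νT, inferInstance, hT', h2⟩, ?_,
      ⟨νW, inferInstance, hW', h3⟩, h4 f hf⟩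
    · rw [hC, marginLeft_cubeCdf hunif,
        Measure.map_map measurable_comp_inl (measurable_joinVec hUm hVm)]
      rfl
    · rw [hC, marginRight_cubeCdf hunif,
        Measure.map_map measurable_comp_inr (measurable_joinVec hUm hVm)]
      rfl
  · have hC : checkerboardCopula P (joinVec X Y) = randomizedCdf P (joinVec X Y)
        (((checkerboardNoise P X).prod (checkerboardNoise P Y)).map (joinNoise P X Y)) := by
      rw [← checkerboardNoise_joinVec]
      rfl
    obtain ⟨h1, h2, h3, h4⟩ := randomizedCdf_joinVec hX hY (map_checkerboardNoise_apply X)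
      (map_checkerboardNoise_apply Y) hC
    have h2' : marginLeft (checkerboardCopula P (joinVec X Y)) = checkerboardCopula P X := h2
    have h3' : marginRight (checkerboardCopula P (joinVec X Y)) = checkerboardCopula P Y := h3
    -- The checkerboard copula attains the lower bound `part1`, so the infimum is a minimum.
    refine ⟨h1, h2', h3', ?_, ⟨_, h1, h4 f hf⟩, ?_⟩
    · rw [← h2', ← h3']
      exact h4 f hf
    · rintro d ⟨C, hC, rfl⟩
      exact part1 C hC
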